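/- **Setting.** Let $n\ge 0$ be an integer, $A,A_1\in\mathbb R^{n\times n}$, $B\in\mathbb R^{n\times 1}$, $a,a_2\in\mathbb R$. For $K\in\mathbb R^{1\times n}$ and $c>0$ put $$\gamma(x)=\begin{bmatrix}K&0\end{bmatrix}\exp\!\left(\begin{bmatrix}0&A-aI\\ I&0\end{bmatrix}x\right)\begin{bmatrix}I\\0\end{bmatrix},\qquad q(x,y)=-(a+c)\,x\,\frac{I_1\big(\sqrt{(a+c)(x^2-y^2)}\big)}{\sqrt{(a+c)(x^2-y^2)}},\qquad I_1(s)=\sum_{k\ge0}\frac{(s/2)^{2k+1}}{k!\,(k+1)!},$$ where $I_1(\sqrt s)/\sqrt s$ denotes the entire function $\sum_{k\ge 0}\frac12\frac{(s/4)^k}{k!(k+1)!}$ of $s$. The target system (with Dirichlet condition) is, for $t\ge 0$ and $x\in(0,1)$, $$\begin{aligned}&\dot X(t)=(A+BK)X(t)+A_1X(t-\tau(t))+Bz(0,t),\\ &z_t(x,t)=z_{xx}(x,t)-cz(x,t)+a_2z(x,t-\tau(t))-\Big[\gamma(x)-\int_0^xq(x,y)\gamma(y)\,dy\Big](A_1-a_2I)X(t-\tau(t)),\\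 &z_x(0,t)=0,\qquad z(1,t)=0,\qquad (X(t),z(\cdot,t))=(f(t),\varphi(\cdot,t))\ \text{ for } -h\le t\le 0,\end{aligned}$$ where the delay $\tau$ is continuously differentiable on $[0,\infty)$ with $0<h_0\le\tau(t)\le h$. Let $\mathcal H=\mathbb R^n\times L^2(0,1)$ with $\|(X,z)\|^2=|X|^2+\int_0^1z^2dx$, and let $D=\{(X,z)\in\mathbb R^n\times H^2(0,1): z_x(0)=0,\ z(1)=0\}$ with the norm of $\mathbb R^n\times H^2(0,1)$. Initial data $(f,\varphi)$ are taken in $W=C([-h,0],D)\cap C^1([-h,0],\mathcal H)$, and a solution is a classical one: its restriction to $[0,\infty)$ lies in $C([0,\infty),D)\cap C^1([0,\infty),\mathcal H)$ and satisfies the equations for all $t\ge0$. For $\delta_0,\delta_1,r,p_1,\lambda\in\mathbb R$ with $r\neq 0$ and a symmetric $P\in\mathbb R^{n\times n}$ let $$\Theta_1=\begin{bmatrix}P(A+BK)+(A+BK)^\top P+2\delta_0P&PA_1&PB\\ *&-2\delta_1P+p_1r^{-1}\zeta(A_1-a_2I)^\top(A_1-a_2I)&0\\ *&*&-\lambda\end{bmatrix},$$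 $$\Theta_2=\begin{bmatrix}\big(-2c+2\delta_0+r-\tfrac{\pi^2}{2}\big)p_1+\tfrac{\pi^2}{4}\lambda&a_2p_1\\ *&-2\delta_1p_1\end{bmatrix},\qquad \zeta=\Big(1+\max_{0\le y\le x\le1}|q(x,y)|\Big)^2\Big(\max_{0\le x\le1}|\gamma(x)|\Big)^2,$$ where $*$ stands for the entries determined by symmetry, and $M<0$ (resp. $M>0$) means symmetric and negative (resp. positive) definite. Let $V(t)=X(t)^\top PX(t)+p_1\int_0^1z(x,t)^2dx$. **(i)** Fix $K$, $c>0$, $r>0$ and $0<\delta_1<\delta_0$, and suppose that $P>0$, $p_1>0$ and $0<\lambda\le2p_1$ satisfy $\Theta_1<0$ and $\Theta_2<0$. Then for every $h>0$ the equation $\delta=\delta_0-\delta_1e^{2\delta h}$ has a unique real solution $\delta$, it is positive, and for every $h_0>0$, every delay $\tau$ with values in $[h_0,h]$ and all initial data in $W$, every solution satisfies $$V(t)\le e^{-2\delta t}\sup_{-h\le\theta\le0}V(\theta),\qquad t\ge0.\tag{1}$$ If instead $\delta_0=\delta_1>0$ and $\Theta_1<0$, $\Theta_2<0$ hold for some $P>0$,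 $p_1>0$, $0<\lambda\le2p_1$, then for every $h>0$ there is $\delta>0$ such that (1) holds for all $h_0>0$, all such delays, all initial data in $W$ and all solutions. **(ii)** Suppose that $A_1=a_1I$ for some $a_1\in\mathbb R$ and that $(A,B)$ is controllable, i.e. $\operatorname{rank}[B,AB,\dots,A^{n-1}B]=n$. Then for every $h>0$ and every $\delta>0$ there are $K\in\mathbb R^{1\times n}$ and $c>0$ such that the target system is exponentially stable with decay rate $\delta$: there is $M>0$ such that for all $h_0>0$, all delays $\tau$ with values in $[h_0,h]$, all initial data in $W$ and all solutions $$\|(X(t),z(\cdot,t))\|_{\mathcal H}\le M e^{-\delta t}\sup_{-h\le\theta\le0}\|(X(\theta),z(\cdot,\theta))\|_{\mathcal H},\qquad t\ge0 .$$ -/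

import Mathlib

open Set MeasureTheory
open scoped Matrix ContDiff

noncomputable section

namespace Cascade

/-! ### The backstepping kernels -/

/-- The modified Bessel function of the first kind and first order. -/
def besselI1 (s : ℝ) : ℝ :=
  ∑' n : ℕ, (s / 2) ^ (2 * n + 1) / ((n.factorial : ℝ) * ((n + 1).factorial : ℝ))

/-- The entire function `s ↦ I₁(√s) / √s`, written as a power series in `s`, so that it has its
usual value also at `s = 0` (where the quotient is `1 / 2`) and for negative `s`. -/
def besselI1Quot (s : ℝ) : ℝ :=
  ∑' n : ℕ, (1 / 2) * (s / 4) ^ n / ((n.factorial : ℝ) * ((n + 1).factorial : ℝ))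

theorem besselI1Quot_eq {s : ℝ} (hs : 0 < s) :
    besselI1Quot s = besselI1 (Real.sqrt s) / Real.sqrt s := by
  have h0 : Real.sqrt s ≠ 0 := (Real.sqrt_pos.mpr hs).ne'
  unfold besselI1Quot besselI1
  rw [← tsum_div_const]
  congr 1
  funext n
  have h1 : (s / 4) ^ n = (Real.sqrt s / 2) ^ (2 * n) := by
    have h2 : (Real.sqrt s / 2) ^ 2 = s / 4 := by
      rw [div_pow, Real.sq_sqrt hs.le]
      norm_num
    rw [pow_mul, h2]
  rw [h1, pow_succ]
  field_simp

/-- The scalar kernel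
`q(x,y) = -(a+c) x I₁(√((a+c)(x²-y²))) / √((a+c)(x²-y²))`. -/
def kernelQ (a c x y : ℝ) : ℝ :=
  -(a + c) * x * besselI1Quot ((a + c) * (x ^ 2 - y ^ 2))

/-- The row vector `γ(x) = [K 0] exp([[0, A - aI], [I, 0]] x) [I; 0]`. -/
def gammaRow {n : ℕ} (A : Matrix (Fin n) (Fin n) ℝ) (K : Matrix (Fin 1) (Fin n) ℝ)
    (a x : ℝ) : Matrix (Fin 1) (Fin n) ℝ :=
  Matrix.fromCols K (0 : Matrix (Fin 1) (Fin n) ℝ) *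
    NormedSpace.exp (x • Matrix.fromBlocks (0 : Matrix (Fin n) (Fin n) ℝ)
      (A - a • (1 : Matrix (Fin n) (Fin n) ℝ)) (1 : Matrix (Fin n) (Fin n) ℝ) 0) *
    Matrix.fromRows (1 : Matrix (Fin n) (Fin n) ℝ) (0 : Matrix (Fin n) (Fin n) ℝ)

/-- The row vector `γ(x) - ∫₀ˣ q(x,y) γ(y) dy`. -/
def couplingRow {n : ℕ} (A : Matrix (Fin n) (Fin n) ℝ) (K : Matrix (Fin 1) (Fin n) ℝ)
    (a c x : ℝ) : Matrix (Fin 1) (Fin n) ℝ :=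
  Matrix.of fun i j =>
    gammaRow A K a x i j - ∫ y in (0 : ℝ)..x, kernelQ a c x y * gammaRow A K a y i j

/-! ### The matrix inequalities -/

/-- `M < 0`: the matrix is symmetric and negative definite. -/
def NegDef {ι : Type*} (M : Matrix ι ι ℝ) : Prop := (-M).PosDef

/-- `ζ = (1 + max_{0≤y≤x≤1} |q(x,y)|)² (max_{0≤x≤1} |γ(x)|)²`, with the Euclidean norm of the
row vector `γ(x)`. The suprema are those of continuous functions on nonempty compact sets. -/
def zeta {n : ℕ} (A : Matrix (Fin n) (Fin n) ℝ) (K : Matrix (Fin 1) (Fin n) ℝ)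
    (a c : ℝ) : ℝ :=
  (1 + sSup ((fun p : ℝ × ℝ => |kernelQ a c p.1 p.2|) ''
      {p : ℝ × ℝ | 0 ≤ p.2 ∧ p.2 ≤ p.1 ∧ p.1 ≤ 1})) ^ 2 *
    (sSup ((fun x : ℝ => Real.sqrt (∑ j, gammaRow A K a x 0 j ^ 2)) '' Icc (0 : ℝ) 1)) ^ 2

/-- The symmetric block matrix
`Ξ = [[θ₁₁, P A₁, P B], [*, -2 δ₁ P, 0], [*, *, -λ]]` with
`θ₁₁ = P (A + B K) + (A + B K)ᵀ P + 2 δ₀ P`. -/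
def Xi {n : ℕ} (A A₁ : Matrix (Fin n) (Fin n) ℝ) (B : Matrix (Fin n) (Fin 1) ℝ)
    (K : Matrix (Fin 1) (Fin n) ℝ) (P : Matrix (Fin n) (Fin n) ℝ) (lam δ₀ δ₁ : ℝ) :
    Matrix ((Fin n ⊕ Fin n) ⊕ Fin 1) ((Fin n ⊕ Fin n) ⊕ Fin 1) ℝ :=
  Matrix.fromBlocks
    (Matrix.fromBlocks
      (P * (A + B * K) + (A + B * K)ᵀ * P + (2 * δ₀) • P) (P * A₁)
      (P * A₁)ᵀ (-(2 * δ₁) • P))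
    (Matrix.fromRows (P * B) 0)
    (Matrix.fromRows (P * B) 0)ᵀ
    (-lam • (1 : Matrix (Fin 1) (Fin 1) ℝ))

/-- `R = diag{0, ζ (A₁ - a₂ I)ᵀ (A₁ - a₂ I), 0}`. -/
def Rmat {n : ℕ} (A A₁ : Matrix (Fin n) (Fin n) ℝ) (K : Matrix (Fin 1) (Fin n) ℝ)
    (a a₂ c : ℝ) : Matrix ((Fin n ⊕ Fin n) ⊕ Fin 1) ((Fin n ⊕ Fin n) ⊕ Fin 1) ℝ :=
  Matrix.fromBlocks
    (Matrix.fromBlocks 0 0 0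
      (zeta A K a c • ((A₁ - a₂ • (1 : Matrix (Fin n) (Fin n) ℝ))ᵀ *
        (A₁ - a₂ • (1 : Matrix (Fin n) (Fin n) ℝ)))))
    0 0 0

/-- `Θ₁ = Ξ + p₁ r⁻¹ R`. -/
def Theta1 {n : ℕ} (A A₁ : Matrix (Fin n) (Fin n) ℝ) (B : Matrix (Fin n) (Fin 1) ℝ)
    (a a₂ : ℝ) (K : Matrix (Fin 1) (Fin n) ℝ) (c r : ℝ) (P : Matrix (Fin n) (Fin n) ℝ)
    (p₁ lam δ₀ δ₁ : ℝ) :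
    Matrix ((Fin n ⊕ Fin n) ⊕ Fin 1) ((Fin n ⊕ Fin n) ⊕ Fin 1) ℝ :=
  Xi A A₁ B K P lam δ₀ δ₁ + (p₁ * r⁻¹) • Rmat A A₁ K a a₂ c

/-- `Θ₂ = [[(-2c + 2δ₀ + r - π²/2) p₁ + (π²/4) λ, a₂ p₁], [*, -2 δ₁ p₁]]`. -/
def Theta2 (a₂ c r p₁ lam δ₀ δ₁ : ℝ) : Matrix (Fin 2) (Fin 2) ℝ :=
  !![(-2 * c + 2 * δ₀ + r - Real.pi ^ 2 / 2) * p₁ + Real.pi ^ 2 / 4 * lam, a₂ * p₁;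
     a₂ * p₁, -2 * δ₁ * p₁]

/-- Kalman's rank condition `rank [B, AB, …, Aⁿ⁻¹B] = n` for the single-input pair `(A, B)`. -/
def Controllable {n : ℕ} (A : Matrix (Fin n) (Fin n) ℝ) (B : Matrix (Fin n) (Fin 1) ℝ) :
    Prop :=
  (Matrix.of fun (i : Fin n) (k : Fin n) => (A ^ (k : ℕ) * B) i 0).rank = n

/-! ### The target system

The state is `(X, z)` with `X ∈ ℝⁿ` and `z ∈ L²(0,1)`. -/

/-- Lebesgue measure on `(0,1)`. -/
abbrev unitMeasure : Measure ℝ := volume.restrict (Ioo (0 : ℝ) 1)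

/-- The real Hilbert space `L²(0,1)`. -/
abbrev L2unit : Type := Lp ℝ 2 unitMeasure

/-- `z ∈ H²(0,1)` with `z_x(0) = 0` and `z(1) = 0`; `u` is the continuous representative of `z`
on `[0,1]` and `w = z_xx ∈ L²(0,1)`. Membership in `H²(0,1)` means that `z` has a representative
which is continuously differentiable on `[0,1]`, whose derivative `v` is absolutely continuous
and has its a.e. derivative in `L²(0,1)`. -/
def InDomain (z : L2unit) (u : ℝ → ℝ) (w : L2unit) : Prop :=
  (z =ᵐ[unitMeasure] u) ∧
  ∃ v : ℝ → ℝ,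
    (∀ x ∈ Icc (0 : ℝ) 1, HasDerivWithinAt u (v x) (Icc 0 1) x) ∧
    AbsolutelyContinuousOnInterval v 0 1 ∧
    (∀ᵐ x ∂unitMeasure, HasDerivAt v (w x) x) ∧
    v 0 = 0 ∧ u 1 = 0

/-- The path `t ↦ (X(t), z(t))` belongs to `C(S, D) ∩ C¹(S, ℝⁿ × L²(0,1))`, where
`D = {(X, z) : z ∈ H²(0,1), z_x(0) = 0, z(1) = 0}` carries the graph norm, that is, the norm of
`ℝⁿ × H²(0,1)`, equivalently `|X| + ‖z‖ + ‖z_xx‖`. Here `u t` is the continuous representative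
of `z t` and `w t = z_xx(·, t)`. -/
def RegularPath {n : ℕ} (S : Set ℝ) (X : ℝ → Fin n → ℝ) (z : ℝ → L2unit)
    (u : ℝ → ℝ → ℝ) (w : ℝ → L2unit) : Prop :=
  ContDiffOn ℝ 1 X S ∧ ContDiffOn ℝ 1 z S ∧ ContinuousOn w S ∧
    ∀ t ∈ S, InDomain (z t) (u t) (w t)

/-- The class `W = C([-h,0], D) ∩ C¹([-h,0], ℝⁿ × L²(0,1))` of initial data. -/
def InitialClass {n : ℕ} (h : ℝ) (f : ℝ → Fin n → ℝ) (φ : ℝ → L2unit) : Prop :=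
  ∃ u w, RegularPath (Icc (-h) 0) f φ u w

/-- A continuously differentiable delay with `0 < h₀ ≤ τ(t) ≤ h` for `t ≥ 0`. -/
def IsDelay (h₀ h : ℝ) (τ : ℝ → ℝ) : Prop :=
  0 < h₀ ∧ ContDiffOn ℝ 1 τ (Ici 0) ∧ ∀ t, 0 ≤ t → h₀ ≤ τ t ∧ τ t ≤ h

/-- `(X, z)` is a classical solution on `[0, ∞)` of
`X'(t) = (A + BK) X(t) + A₁ X(t - τ(t)) + B z(0,t)`,
`z_t = z_xx - c z + a₂ z(x, t - τ(t)) - [γ(x) - ∫₀ˣ q(x,y) γ(y) dy] (A₁ - a₂ I) X(t - τ(t))`,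
`z_x(0,t) = 0`, `z(1,t) = 0`, and `(X, z) = (f, φ)` on `[-h, 0]`. -/
def IsClassicalSolution {n : ℕ} (A A₁ : Matrix (Fin n) (Fin n) ℝ)
    (B : Matrix (Fin n) (Fin 1) ℝ) (a a₂ : ℝ) (K : Matrix (Fin 1) (Fin n) ℝ) (c : ℝ)
    (h : ℝ) (τ : ℝ → ℝ) (f : ℝ → Fin n → ℝ) (φ : ℝ → L2unit)
    (X : ℝ → Fin n → ℝ) (z : ℝ → L2unit) : Prop :=
  (∀ θ ∈ Icc (-h) 0, X θ = f θ ∧ z θ = φ θ) ∧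
  ∃ (u : ℝ → ℝ → ℝ) (w : ℝ → L2unit), RegularPath (Ici 0) X z u w ∧
    ∀ t, 0 ≤ t →
      HasDerivWithinAt X
        ((A + B * K) *ᵥ X t + A₁ *ᵥ X (t - τ t) + B *ᵥ (fun _ => u t 0)) (Ici 0) t ∧
      ∃ zt : L2unit, HasDerivWithinAt z zt (Ici 0) t ∧
        ∀ᵐ x ∂unitMeasure, zt x = w t x - c * z t x + a₂ * z (t - τ t) x -
          (couplingRow A K a c x *ᵥ
            ((A₁ - a₂ • (1 : Matrix (Fin n) (Fin n) ℝ)) *ᵥ X (t - τ t))) 0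

/-- `V(t) = X(t)ᵀ P X(t) + p₁ ∫₀¹ z(x,t)² dx`. -/
def lyapunovV {n : ℕ} (P : Matrix (Fin n) (Fin n) ℝ) (p₁ : ℝ)
    (X : ℝ → Fin n → ℝ) (z : ℝ → L2unit) (t : ℝ) : ℝ :=
  X t ⬝ᵥ (P *ᵥ X t) + p₁ * ∫ x, (z t x) ^ 2 ∂unitMeasure

/-- The norm of `(X(t), z(t))` in `ℝⁿ × L²(0,1)`, with the Euclidean norm on `ℝⁿ`. -/
def stateNorm {n : ℕ} (X : ℝ → Fin n → ℝ) (z : ℝ → L2unit) (t : ℝ) : ℝ :=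
  Real.sqrt (X t ⬝ᵥ X t + ∫ x, (z t x) ^ 2 ∂unitMeasure)

/-- `V(t) ≤ e^{-2δt} sup_{-h≤θ≤0} V(θ)`, `t ≥ 0`, for all delays with values in `[h₀, h]`, all
initial data in `W` and all classical solutions. -/
def HalanayBound {n : ℕ} (A A₁ : Matrix (Fin n) (Fin n) ℝ)
    (B : Matrix (Fin n) (Fin 1) ℝ) (a a₂ : ℝ) (K : Matrix (Fin 1) (Fin n) ℝ) (c : ℝ)
    (P : Matrix (Fin n) (Fin n) ℝ) (p₁ h δ : ℝ) : Prop :=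
  ∀ (h₀ : ℝ) (τ : ℝ → ℝ), IsDelay h₀ h τ →
    ∀ (f : ℝ → Fin n → ℝ) (φ : ℝ → L2unit), InitialClass h f φ →
      ∀ (X : ℝ → Fin n → ℝ) (z : ℝ → L2unit),
        IsClassicalSolution A A₁ B a a₂ K c h τ f φ X z →
          ∀ t, 0 ≤ t → lyapunovV P p₁ X z t ≤
            Real.exp (-2 * δ * t) * sSup (lyapunovV P p₁ X z '' Icc (-h) 0)

/-- Exponential stability with decay rate `δ` in the norm of `ℝⁿ × L²(0,1)`: a constant `M`,
independent of the delay, of the initial data and of time, such that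
`‖(X(t), z(t))‖ ≤ M e^{-δt} sup_{-h≤θ≤0} ‖(X(θ), z(θ))‖` for all `t ≥ 0`. -/
def ExpStable {n : ℕ} (A A₁ : Matrix (Fin n) (Fin n) ℝ)
    (B : Matrix (Fin n) (Fin 1) ℝ) (a a₂ : ℝ) (K : Matrix (Fin 1) (Fin n) ℝ) (c : ℝ)
    (h δ : ℝ) : Prop :=
  ∃ M : ℝ, 0 < M ∧
    ∀ (h₀ : ℝ) (τ : ℝ → ℝ), IsDelay h₀ h τ →
      ∀ (f : ℝ → Fin n → ℝ) (φ : ℝ → L2unit), InitialClass h f φ →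
        ∀ (X : ℝ → Fin n → ℝ) (z : ℝ → L2unit),
          IsClassicalSolution A A₁ B a a₂ K c h τ f φ X z →
            ∀ t, 0 ≤ t → stateNorm X z t ≤
              M * Real.exp (-δ * t) * sSup (stateNorm X z '' Icc (-h) 0)

end Cascade

end

/-!
The system is studied through the weighted functional
`V(t) = X(t)ᵀ P X(t) + p₁ ∫₀¹ e^{-2μx} z(x,t)² dx` with `μ ≥ 0`; the weight `μ = 0` gives the
functional of part (i). With `y = e^{-μx} z`, the boundary conditions give
`∫ e^{-2μx} z z_xx = -∫ y_x² + μ² ∫ y²`, and `∫ y_x²` dominates both `z(0)²` and `(π²/4) ∫ y²`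
(`InDomain.weighted_energy_le`). So `V` sees the reaction coefficient `c - μ²` in place of `c`, and
the coupling row only through its weighted size. If the quadratic forms of `Θ₁` and `Θ₂`, with these
replacements, are nonpositive (`WeightedLMI`), then `V' ≤ -2δ₀ V + 2δ₁ V(t - τ(t))` along solutions
(`WeightedLMI.exists_hasDerivWithinAt`), and Halanay's inequality (`halanay`) yields decay at the
rate `δ = δ₀ - δ₁ e^{2δh}` (`WeightedLMI.weightedV_le`).

For part (i), `μ = 0`, and `ζ` bounds the coupling row. When `δ₀ = δ₁`, strictness of the matrix
inequalities leaves room to increase `δ₀` (`WeightedLMI.exists_of_negDef`).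

For part (ii), the unweighted functional does not suffice: a large decay rate needs a large `c`, but
`ζ` grows exponentially in `√c`. The weight removes this growth. Put `c = s² - a`. Since
`∫₀ˣ |q(x,y)| dy = cosh(s x) - 1` (`integral_abs_kernelQ`), the coupling row is at most
`max |γ| e^{s x}`, so with `μ = s - 1` its weighted size is bounded independently of `s`, while
`c - μ² = 2s - 1 - a` tends to infinity. The feedback `K` is chosen beforehand from the
controllability Gramian (`Controllable.exists_feedback`), after which the inequalities hold for all
large `s` (`Controllable.exists_weightedLMI`).
-/

namespace Cascade

/-! ### Halanay's inequality -/

theorem exists_unique_decay_rate {δ₀ δ₁ h : ℝ} (h₁ : 0 < δ₁) (h₀₁ : δ₁ < δ₀) (hh : 0 < h) :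
    ∃ δ : ℝ, 0 < δ ∧ δ = δ₀ - δ₁ * Real.exp (2 * δ * h) ∧
      ∀ δ' : ℝ, δ' = δ₀ - δ₁ * Real.exp (2 * δ' * h) → δ' = δ := by
  have hmono : StrictMono fun d : ℝ => d - δ₀ + δ₁ * Real.exp (2 * d * h) := by
    intro x y hxy
    have : Real.exp (2 * x * h) < Real.exp (2 * y * h) := by
      apply Real.exp_lt_exp.mpr
      nlinarith
    have := mul_lt_mul_of_pos_left this h₁
    linarith
  have hcont : ContinuousOn (fun d : ℝ => d - δ₀ + δ₁ * Real.exp (2 * d * h)) (Icc 0 δ₀) := by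
    fun_prop
  have hz : (0 : ℝ) ∈ Icc ((fun d : ℝ => d - δ₀ + δ₁ * Real.exp (2 * d * h)) 0)
      ((fun d : ℝ => d - δ₀ + δ₁ * Real.exp (2 * d * h)) δ₀) := by
    constructor
    · simp only [mul_zero, zero_mul, Real.exp_zero]
      linarith
    · have := Real.exp_pos (2 * δ₀ * h)
      simp only
      nlinarith
  obtain ⟨δ, hδ, hδz⟩ := intermediate_value_Icc (h₁.le.trans h₀₁.le) hcont hz
  simp only at hδz
  have hne : δ ≠ 0 := by
    rintro rfl
    simp only [mul_zero, zero_mul, Real.exp_zero] at hδz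
    linarith
  refine ⟨δ, lt_of_le_of_ne hδ.1 hne.symm, by linarith, fun δ' h' => hmono.injective ?_⟩
  linarith

/-- Halanay's inequality for a delay bounded away from `0`. The bound is propagated over successive
intervals of length `h₀`, on each of which the delayed term is already controlled. -/
theorem halanay {V V' τ : ℝ → ℝ} {h₀ h S δ δ₀ δ₁ : ℝ} (hh₀ : 0 < h₀)
    (hτ : ∀ t, 0 ≤ t → h₀ ≤ τ t ∧ τ t ≤ h) (hS : 0 ≤ S) (hδ : 0 ≤ δ) (hδ₁ : 0 ≤ δ₁)
    (hrate : δ = δ₀ - δ₁ * Real.exp (2 * δ * h))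
    (hinit : ∀ θ ∈ Icc (-h) 0, V θ ≤ S)
    (hderiv : ∀ t, 0 ≤ t → HasDerivWithinAt V (V' t) (Ici 0) t)
    (hineq : ∀ t, 0 ≤ t → V' t ≤ -2 * δ₀ * V t + 2 * δ₁ * V (t - τ t)) :
    ∀ t, 0 ≤ t → V t ≤ Real.exp (-2 * δ * t) * S := by
  have hh : 0 ≤ h := by
    have := hτ 0 le_rfl
    linarith
  have key : ∀ k : ℕ, ∀ t ∈ Icc (-h) (k * h₀), V t ≤ Real.exp (-2 * δ * t) * S := by
    intro k
    induction k with
    | zero =>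
      intro t ht
      simp only [Nat.cast_zero, zero_mul] at ht
      refine (hinit t ht).trans (le_mul_of_one_le_left hS (Real.one_le_exp ?_))
      nlinarith [ht.2]
    | succ k ih =>
      intro t ht
      rcases le_total t (k * h₀) with htk | htk
      · exact ih t ⟨ht.1, htk⟩
      have hk : 0 ≤ (k : ℝ) * h₀ := by positivity
      -- compare `e^{2δ₀t} V(t)` with `e^{2δ₀t} e^{-2δt} S`
      have hexp : ∀ (d x : ℝ), HasDerivAt (fun x => Real.exp (d * x)) (Real.exp (d * x) * d) x := by
        intro d x
        simpa using ((hasDerivAt_id x).const_mul d).exp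
      have hcmp : Real.exp (2 * δ₀ * t) * V t ≤
          Real.exp (2 * δ₀ * t) * (Real.exp (-2 * δ * t) * S) := by
        refine image_le_of_deriv_right_le_deriv_boundary
          (f := fun x => Real.exp (2 * δ₀ * x) * V x)
          (B := fun x => Real.exp (2 * δ₀ * x) * (Real.exp (-2 * δ * x) * S))
          (f' := fun x => Real.exp (2 * δ₀ * x) * (2 * δ₀) * V x + Real.exp (2 * δ₀ * x) * V' x)
          (B' := fun x => Real.exp (2 * δ₀ * x) * (2 * δ₀) * (Real.exp (-2 * δ * x) * S) +
            Real.exp (2 * δ₀ * x) * (Real.exp (-2 * δ * x) * (-2 * δ) * S))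
          (a := k * h₀) (b := (k + 1 : ℕ) * h₀) ?_ ?_ ?_ ?_ ?_ ?_ ⟨htk, ht.2⟩
        · intro x hx
          have h1 := (hderiv x (hk.trans hx.1)).continuousWithinAt.mono
            (fun y hy => hk.trans hy.1 : Icc ((k : ℝ) * h₀) ((k + 1 : ℕ) * h₀) ⊆ Ici 0)
          have h2 : Continuous fun x => Real.exp (2 * δ₀ * x) := by fun_prop
          exact h2.continuousWithinAt.mul h1
        · intro x hx
          have h1 := (hderiv x (hk.trans hx.1)).mono (Ici_subset_Ici.mpr (hk.trans hx.1))
          exact (hexp (2 * δ₀) x).hasDerivWithinAt.mul h1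
        · exact mul_le_mul_of_nonneg_left (ih _ ⟨by linarith, le_rfl⟩) (Real.exp_pos _).le
        · fun_prop
        · intro x hx
          exact ((hexp (2 * δ₀) x).mul ((hexp (-2 * δ) x).mul_const S)).hasDerivWithinAt
        · intro x hx
          have hx0 : 0 ≤ x := hk.trans hx.1
          have hx2 := hx.2
          push_cast at hx2
          obtain ⟨hτ1, hτ2⟩ := hτ x hx0
          have h1 : V (x - τ x) ≤ Real.exp (-2 * δ * (x - τ x)) * S :=
            ih _ ⟨by linarith, by linarith⟩
          have h2 : Real.exp (-2 * δ * (x - τ x)) ≤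
              Real.exp (-2 * δ * x) * Real.exp (2 * δ * h) := by
            rw [← Real.exp_add]
            apply Real.exp_le_exp.mpr
            nlinarith
          have h3 := h1.trans (mul_le_mul_of_nonneg_right h2 hS)
          have h4 := hineq x hx0
          have h5 := mul_le_mul_of_nonneg_left h3 (by linarith : (0 : ℝ) ≤ 2 * δ₁)
          have h6 : δ₁ * Real.exp (2 * δ * h) = δ₀ - δ := by linarith
          have h7 : 2 * δ₁ * (Real.exp (-2 * δ * x) * Real.exp (2 * δ * h) * S) =
              2 * (δ₀ - δ) * (Real.exp (-2 * δ * x) * S) := by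
            rw [← h6]; ring
          have h8 : 2 * δ₀ * V x + V' x ≤ 2 * (δ₀ - δ) * (Real.exp (-2 * δ * x) * S) := by
            linarith
          have h9 := mul_le_mul_of_nonneg_left h8 (Real.exp_pos (2 * δ₀ * x)).le
          linarith
      exact le_of_mul_le_mul_left hcmp (Real.exp_pos _)
  intro t ht
  obtain ⟨k, hk⟩ := exists_nat_ge (t / h₀)
  exact key k t ⟨by linarith, (div_le_iff₀ hh₀).mp hk⟩

/-! ### Quadratic forms -/

theorem dotProduct_self_nonneg' {ι : Type*} [Fintype ι] (x : ι → ℝ) : 0 ≤ x ⬝ᵥ x := by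
  simpa using dotProduct_star_self_nonneg x

theorem sq_dotProduct_le {ι : Type*} [Fintype ι] (x y : ι → ℝ) :
    (x ⬝ᵥ y) ^ 2 ≤ (x ⬝ᵥ x) * (y ⬝ᵥ y) := by
  have := Finset.sum_mul_sq_le_sq_mul_sq Finset.univ x y
  simpa [dotProduct, sq] using this

theorem continuous_quadForm {ι : Type*} [Fintype ι] (M : Matrix ι ι ℝ) :
    Continuous fun x : ι → ℝ => x ⬝ᵥ (M *ᵥ x) := by
  simp only [dotProduct, Matrix.mulVec]
  fun_prop

theorem exists_quadForm_le {ι : Type*} [Fintype ι] (M : Matrix ι ι ℝ) :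
    ∃ C : ℝ, 0 < C ∧ ∀ x : ι → ℝ, x ⬝ᵥ (M *ᵥ x) ≤ C * (x ⬝ᵥ x) := by
  refine ⟨1 + ∑ i, ∑ j, |M i j|, by positivity, fun x => ?_⟩
  have hx : ∀ i, x i ^ 2 ≤ x ⬝ᵥ x := fun i => by
    simp only [dotProduct, ← sq]
    exact Finset.single_le_sum (f := fun i => x i ^ 2) (fun i _ => sq_nonneg _) (Finset.mem_univ i)
  have h1 : x ⬝ᵥ (M *ᵥ x) ≤ ∑ i, ∑ j, |M i j| * (x ⬝ᵥ x) := by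
    simp only [dotProduct, Matrix.mulVec, Finset.mul_sum]
    refine Finset.sum_le_sum fun i _ => Finset.sum_le_sum fun j _ => ?_
    have h2 : |x i * x j| ≤ x ⬝ᵥ x := by
      rw [abs_le]
      have := hx i
      have := hx j
      constructor <;> nlinarith [sq_nonneg (x i + x j), sq_nonneg (x i - x j)]
    calc x i * (M i j * x j) = M i j * (x i * x j) := by ring
      _ ≤ |M i j * (x i * x j)| := le_abs_self _
      _ = |M i j| * |x i * x j| := abs_mul _ _
      _ ≤ |M i j| * (x ⬝ᵥ x) := mul_le_mul_of_nonneg_left h2 (abs_nonneg _)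
      _ = _ := by simp only [dotProduct, Finset.mul_sum]
  have h3 : 0 ≤ x ⬝ᵥ x := dotProduct_self_nonneg' x
  simp only [← Finset.sum_mul] at h1
  linarith

theorem _root_.Matrix.PosDef.dotProduct_mulVec_comm {ι : Type*} [Fintype ι]
    {P : Matrix ι ι ℝ}
    (hP : P.PosDef) (x y : ι → ℝ) : x ⬝ᵥ (P *ᵥ y) = y ⬝ᵥ (P *ᵥ x) := by
  have hT : Pᵀ = P := by simpa [Matrix.IsHermitian] using hP.isHermitian
  rw [Matrix.dotProduct_mulVec, ← Matrix.mulVec_transpose, hT, dotProduct_comm]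

theorem _root_.Matrix.PosDef.exists_le_quadForm {ι : Type*} [Fintype ι] {M : Matrix ι ι ℝ}
    (hM : M.PosDef) : ∃ κ : ℝ, 0 < κ ∧ ∀ x : ι → ℝ, κ * (x ⬝ᵥ x) ≤ x ⬝ᵥ (M *ᵥ x) := by
  classical
  -- With `M⁻¹ ≤ C` and `y = M⁻¹ x`, expand `0 ≤ (x - C⁻¹ y)ᵀ M (x - C⁻¹ y)`.
  obtain ⟨C, hC, hCx⟩ := exists_quadForm_le M⁻¹
  have hu : IsUnit M.det := (Matrix.isUnit_iff_isUnit_det M).mp hM.isUnit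
  refine ⟨C⁻¹, by positivity, fun x => ?_⟩
  set y := M⁻¹ *ᵥ x with hy
  have hMy : M *ᵥ y = x := by
    rw [hy, Matrix.mulVec_mulVec, Matrix.mul_nonsing_inv _ hu, Matrix.one_mulVec]
  have h0 := hM.posSemidef.dotProduct_mulVec_nonneg (x - C⁻¹ • y)
  simp only [star_trivial, Matrix.mulVec_sub, Matrix.mulVec_smul, dotProduct_sub, sub_dotProduct,
    smul_dotProduct, dotProduct_smul, hMy, hM.dotProduct_mulVec_comm y x, smul_eq_mul] at h0
  have h1 := hCx x
  rw [← hy, dotProduct_comm] at h1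
  have h2 := mul_le_mul_of_nonneg_left h1 (by positivity : 0 ≤ C⁻¹ * C⁻¹)
  have h3 : C⁻¹ * C⁻¹ * (C * (x ⬝ᵥ x)) = C⁻¹ * (x ⬝ᵥ x) := by field_simp
  linarith

/-! ### Energy estimates on the unit interval -/

theorem integral_unitMeasure (f : ℝ → ℝ) : ∫ x, f x ∂unitMeasure = ∫ x in (0 : ℝ)..1, f x := by
  rw [intervalIntegral.integral_of_le zero_le_one, integral_Ioc_eq_integral_Ioo]

/-- Wirtinger's inequality for functions vanishing at the right endpoint. -/
theorem wirtinger_right {y y' : ℝ → ℝ}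
    (hy : ∀ x ∈ Icc (0 : ℝ) 1, HasDerivWithinAt y (y' x) (Icc 0 1) x)
    (hy' : ContinuousOn y' (Icc 0 1)) (h1 : y 1 = 0) :
    Real.pi ^ 2 / 4 * ∫ x in (0 : ℝ)..1, y x ^ 2 ≤ ∫ x in (0 : ℝ)..1, y' x ^ 2 := by
  have hyc : ContinuousOn y (Icc 0 1) := fun x hx => (hy x hx).continuousWithinAt
  -- For `k < π / 2`, integrate `(y' + k tan(k x) y)² = y'² - k² y² + (k tan(k x) y²)'`.
  have key : ∀ k ∈ Ioo (0 : ℝ) (Real.pi / 2),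
      k ^ 2 * ∫ x in (0 : ℝ)..1, y x ^ 2 ≤ ∫ x in (0 : ℝ)..1, y' x ^ 2 := by
    intro k hk
    have hcos : ∀ x ∈ Icc (0 : ℝ) 1, Real.cos (k * x) ≠ 0 := fun x hx => by
      refine (Real.cos_pos_of_mem_Ioo ⟨?_, ?_⟩).ne'
      · have := mul_nonneg hk.1.le hx.1
        linarith [Real.pi_pos]
      · have := mul_le_of_le_one_right hk.1.le hx.2
        linarith [hk.2]
    have htan : ContinuousOn (fun x => Real.tan (k * x)) (Icc 0 1) := by
      intro x hx
      exact ((Real.continuousAt_tan.mpr (hcos x hx)).comp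
        (f := fun x => k * x) (by fun_prop)).continuousWithinAt
    set F' : ℝ → ℝ := fun x => k * (k * (1 + Real.tan (k * x) ^ 2)) * y x ^ 2 +
      k * Real.tan (k * x) * (2 * y x * y' x) with hF'
    have hF'c : ContinuousOn F' (Icc 0 1) := by fun_prop
    have hF : ∫ x in (0 : ℝ)..1, F' x =
        k * Real.tan (k * 1) * y 1 ^ 2 - k * Real.tan (k * 0) * y 0 ^ 2 := by
      refine intervalIntegral.integral_eq_sub_of_hasDerivAt_of_le zero_le_one
        (f := fun x => k * Real.tan (k * x) * y x ^ 2) (by fun_prop) ?_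
        (hF'c.intervalIntegrable_of_Icc zero_le_one)
      intro x hx
      have hx' := Ioo_subset_Icc_self hx
      have hyx : HasDerivAt y (y' x) x := (hy x hx').hasDerivAt (Icc_mem_nhds hx.1 hx.2)
      have ht : HasDerivAt (fun x => Real.tan (k * x)) (1 / Real.cos (k * x) ^ 2 * (k * 1)) x :=
        (Real.hasDerivAt_tan (hcos x hx')).comp x ((hasDerivAt_id x).const_mul k)
      convert! (ht.const_mul k).mul (hyx.pow 2) using 1
      rw [← Real.inv_one_add_tan_sq (hcos x hx')]
      simp only [hF', one_div, inv_inv, Pi.pow_apply, Nat.cast_ofNat, Nat.add_one_sub_one]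
      ring
    rw [h1] at hF
    simp only [mul_zero, Real.tan_zero, zero_mul, sub_zero, ne_eq, OfNat.ofNat_ne_zero,
      not_false_eq_true, zero_pow] at hF
    have hpos : 0 ≤ ∫ x in (0 : ℝ)..1, (y' x + k * Real.tan (k * x) * y x) ^ 2 :=
      intervalIntegral.integral_nonneg zero_le_one fun x _ => sq_nonneg _
    have hsplit : ∫ x in (0 : ℝ)..1, (y' x + k * Real.tan (k * x) * y x) ^ 2 =
        (∫ x in (0 : ℝ)..1, y' x ^ 2) - (k ^ 2 * ∫ x in (0 : ℝ)..1, y x ^ 2) +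
          ∫ x in (0 : ℝ)..1, F' x := by
      rw [← intervalIntegral.integral_const_mul, ← intervalIntegral.integral_sub,
        ← intervalIntegral.integral_add]
      · refine intervalIntegral.integral_congr fun x _ => ?_
        simp only [hF']
        ring
      all_goals
        refine ContinuousOn.intervalIntegrable_of_Icc zero_le_one ?_
        fun_prop
    rw [hsplit, hF] at hpos
    linarith
  have hpi := Real.pi_pos
  have hlim := ContinuousWithinAt.closure_le (s := Ioo (0 : ℝ) (Real.pi / 2)) (x := Real.pi / 2)
    (f := fun k => k ^ 2 * ∫ x in (0 : ℝ)..1, y x ^ 2)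
    (g := fun _ => ∫ x in (0 : ℝ)..1, y' x ^ 2)
    (by rw [closure_Ioo (by positivity)]; exact ⟨by positivity, le_rfl⟩)
    (by fun_prop) (by fun_prop) key
  rwa [show Real.pi ^ 2 / 4 = (Real.pi / 2) ^ 2 by ring]

/-- The trace inequality `y(0)² ≤ ∫ y'²` for functions vanishing at the right endpoint. -/
theorem trace_left_sq_le {y y' : ℝ → ℝ}
    (hy : ∀ x ∈ Icc (0 : ℝ) 1, HasDerivWithinAt y (y' x) (Icc 0 1) x)
    (hy' : ContinuousOn y' (Icc 0 1)) (h1 : y 1 = 0) :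
    y 0 ^ 2 ≤ ∫ x in (0 : ℝ)..1, y' x ^ 2 := by
  have hyc : ContinuousOn y (Icc 0 1) := fun x hx => (hy x hx).continuousWithinAt
  have hint : ∫ x in (0 : ℝ)..1, y' x = y 1 - y 0 :=
    intervalIntegral.integral_eq_sub_of_hasDerivAt_of_le zero_le_one hyc
      (fun x hx => (hy x (Ioo_subset_Icc_self hx)).hasDerivAt (Icc_mem_nhds hx.1 hx.2))
      (hy'.intervalIntegrable_of_Icc zero_le_one)
  have hpos : 0 ≤ ∫ x in (0 : ℝ)..1, (y' x + y 0) ^ 2 :=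
    intervalIntegral.integral_nonneg zero_le_one fun x _ => sq_nonneg _
  have hsplit : ∫ x in (0 : ℝ)..1, (y' x + y 0) ^ 2 =
      (∫ x in (0 : ℝ)..1, y' x ^ 2) + (2 * y 0 * ∫ x in (0 : ℝ)..1, y' x) +
        ∫ x in (0 : ℝ)..1, y 0 ^ 2 := by
    rw [← intervalIntegral.integral_const_mul, ← intervalIntegral.integral_add,
      ← intervalIntegral.integral_add]
    · refine intervalIntegral.integral_congr fun x _ => ?_
      ring
    all_goals
      refine ContinuousOn.intervalIntegrable_of_Icc zero_le_one ?_
      fun_prop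
  rw [hsplit, hint, h1] at hpos
  simp only [intervalIntegral.integral_const, sub_zero, one_smul] at hpos
  linarith

/-- The weighted dissipation estimate. With `y = e^{-μx} z`, the boundary conditions make the
boundary terms of the integration by parts vanish and leave
`∫ e^{-2μx} z z_xx = -∫ y_x² + μ² ∫ y²`; part of `∫ y_x²` pays for `z(0)²`, the rest is bounded
below by Wirtinger's inequality. -/
theorem InDomain.weighted_energy_le {z w : L2unit} {u : ℝ → ℝ} (hz : InDomain z u w)
    (μ : ℝ) {p lam : ℝ} (hlam : 0 ≤ lam) (hp : lam ≤ 2 * p) :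
    2 * p * ∫ x, Real.exp (-(2 * μ) * x) * (z x * w x) ∂unitMeasure + lam * u 0 ^ 2 ≤
      (2 * p * μ ^ 2 - (2 * p - lam) * (Real.pi ^ 2 / 4)) *
        ∫ x, Real.exp (-(2 * μ) * x) * z x ^ 2 ∂unitMeasure := by
  obtain ⟨hzu, v, hu, hvac, hvw, hv0, hu1⟩ := hz
  have huc : ContinuousOn u (Icc 0 1) := fun x hx => (hu x hx).continuousWithinAt
  have hvc : ContinuousOn v (Icc 0 1) := by
    simpa [uIcc_of_le (zero_le_one' ℝ)] using hvac.continuousOn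
  have hexp : ∀ (d x : ℝ), HasDerivAt (fun x => Real.exp (d * x)) (Real.exp (d * x) * d) x := by
    intro d x
    simpa using ((hasDerivAt_id x).const_mul d).exp
  -- `y = e^{-μx} u`
  set y : ℝ → ℝ := fun x => Real.exp (-μ * x) * u x with hy_def
  set y' : ℝ → ℝ := fun x => Real.exp (-μ * x) * (v x - μ * u x) with hy'_def
  have hy : ∀ x ∈ Icc (0 : ℝ) 1, HasDerivWithinAt y (y' x) (Icc 0 1) x := fun x hx => by
    refine ((hexp (-μ) x).hasDerivWithinAt.mul (hu x hx)).congr_deriv ?_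
    simp only [hy'_def]
    ring
  have hy'c : ContinuousOn y' (Icc 0 1) := by fun_prop
  have hy1 : y 1 = 0 := by simp [hy_def, hu1]
  have hW := wirtinger_right hy hy'c hy1
  have hT := trace_left_sq_le hy hy'c hy1
  have hy0 : y 0 = u 0 := by simp [hy_def]
  rw [hy0] at hT
  have hsq : ∀ x : ℝ, Real.exp (-μ * x) ^ 2 = Real.exp (-(2 * μ) * x) := fun x => by
    rw [← Real.exp_nat_mul]
    congr 1
    push_cast
    ring
  have hI : ∫ x, Real.exp (-(2 * μ) * x) * z x ^ 2 ∂unitMeasure =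
      ∫ x in (0 : ℝ)..1, y x ^ 2 := by
    rw [← integral_unitMeasure]
    refine integral_congr_ae ?_
    filter_upwards [hzu] with x hx
    simp only [hy_def, hx, mul_pow, hsq]
  -- integration by parts with `f = e^{-2μx} u` and `v = u_x`
  set f : ℝ → ℝ := fun x => Real.exp (-(2 * μ) * x) * u x with hf_def
  set f' : ℝ → ℝ := fun x => Real.exp (-(2 * μ) * x) * (v x - 2 * μ * u x) with hf'_def
  have hf : ∀ x ∈ Icc (0 : ℝ) 1, HasDerivWithinAt f (f' x) (Icc 0 1) x := fun x hx => by
    refine ((hexp (-(2 * μ)) x).hasDerivWithinAt.mul (hu x hx)).congr_deriv ?_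
    simp only [hf'_def]
    ring
  have hf'c : ContinuousOn f' (Icc 0 1) := by fun_prop
  have hfac : AbsolutelyContinuousOnInterval f 0 1 := by
    obtain ⟨C, hC⟩ := isCompact_Icc.exists_bound_of_continuousOn hf'c
    have hL : LipschitzOnWith C.toNNReal f (Icc 0 1) := by
      refine (convex_Icc 0 1).lipschitzOnWith_of_nnnorm_hasDerivWithin_le hf fun x hx => ?_
      exact NNReal.le_toNNReal_of_coe_le (hC x hx)
    rw [← uIcc_of_le (zero_le_one' ℝ)] at hL
    exact hL.absolutelyContinuousOnInterval
  have hparts := hfac.integral_mul_deriv_eq_deriv_mul hvac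
  have hf1 : f 1 = 0 := by simp [hf_def, hu1]
  rw [hf1, hv0, ← integral_unitMeasure, ← integral_unitMeasure] at hparts
  have hL : ∫ x, f x * deriv v x ∂unitMeasure =
      ∫ x, Real.exp (-(2 * μ) * x) * (z x * w x) ∂unitMeasure := by
    refine integral_congr_ae ?_
    filter_upwards [hzu, hvw] with x hx hx'
    simp only [hf_def, hx, hx'.deriv]
    ring
  have hR : ∫ x, deriv f x * v x ∂unitMeasure =
      (∫ x in (0 : ℝ)..1, y' x ^ 2) - μ ^ 2 * ∫ x in (0 : ℝ)..1, y x ^ 2 := by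
    have : ∫ x, deriv f x * v x ∂unitMeasure =
        ∫ x, (y' x ^ 2 - μ ^ 2 * y x ^ 2) ∂unitMeasure := by
      refine integral_congr_ae ?_
      filter_upwards [ae_restrict_mem measurableSet_Ioo] with x hx
      rw [((hf x (Ioo_subset_Icc_self hx)).hasDerivAt (Icc_mem_nhds hx.1 hx.2)).deriv]
      simp only [hf'_def, hy'_def, hy_def, mul_pow, hsq]
      ring
    rw [this, integral_unitMeasure, ← intervalIntegral.integral_const_mul,
      intervalIntegral.integral_sub]
    all_goals
      refine ContinuousOn.intervalIntegrable_of_Icc zero_le_one ?_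
      fun_prop
  rw [hL, hR] at hparts
  rw [hI, hparts]
  have h1 := mul_le_mul_of_nonneg_left hT hlam
  have h2 := mul_le_mul_of_nonneg_left hW (by linarith : 0 ≤ 2 * p - lam)
  linarith

/-! ### The backstepping kernel and the coupling row -/

/-- The terms of the series of `besselI1Quot` on the ball of radius `R` are dominated by those of
an exponential series. -/
theorem norm_besselI1Quot_term_le {s R : ℝ} (hs : |s| ≤ R) (n : ℕ) :
    ‖(1 / 2) * (s / 4) ^ n / ((n.factorial : ℝ) * ((n + 1).factorial : ℝ))‖ ≤
      (R / 4) ^ n / n.factorial := by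
  have h1 : (1 : ℝ) ≤ ((n + 1).factorial : ℝ) := by
    exact_mod_cast Nat.one_le_iff_ne_zero.mpr (Nat.factorial_ne_zero (n + 1))
  have h2 : (0 : ℝ) < n.factorial := by positivity
  have h3 : (|s| / 4) ^ n ≤ (R / 4) ^ n := by gcongr
  have h4 : (0 : ℝ) ≤ (|s| / 4) ^ n := by positivity
  rw [norm_div, norm_mul, norm_mul, norm_pow, norm_div]
  simp only [Real.norm_eq_abs, Nat.abs_cast]
  rw [abs_one, abs_two, abs_div, abs_of_nonneg (by norm_num : (0 : ℝ) ≤ 4)]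
  apply div_le_div₀
  · linarith
  · linarith
  · exact h2
  · nlinarith

theorem summable_besselI1Quot (s : ℝ) :
    Summable fun n : ℕ =>
      (1 / 2) * (s / 4) ^ n / ((n.factorial : ℝ) * ((n + 1).factorial : ℝ)) :=
  .of_norm_bounded (Real.summable_pow_div_factorial (|s| / 4))
    fun n => norm_besselI1Quot_term_le le_rfl n

theorem continuous_besselI1Quot : Continuous besselI1Quot := by
  rw [continuous_iff_continuousAt]
  intro s
  have h : ContinuousOn besselI1Quot (Icc (-(|s| + 1)) (|s| + 1)) := by
    refine continuousOn_tsum (fun n => by fun_prop)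
      (Real.summable_pow_div_factorial ((|s| + 1) / 4)) fun n x hx => ?_
    exact norm_besselI1Quot_term_le (abs_le.mpr hx) n
  exact h.continuousAt (Icc_mem_nhds (by linarith [neg_abs_le s]) (by linarith [le_abs_self s]))

theorem besselI1Quot_nonneg {s : ℝ} (hs : 0 ≤ s) : 0 ≤ besselI1Quot s :=
  tsum_nonneg fun n => by positivity

theorem continuous_kernelQ (a c : ℝ) : Continuous fun p : ℝ × ℝ => kernelQ a c p.1 p.2 := by
  have := continuous_besselI1Quot
  unfold kernelQ
  fun_prop

theorem integral_sq_sub_sq_pow (x : ℝ) (n : ℕ) :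
    ∫ y in (0 : ℝ)..x, (x ^ 2 - y ^ 2) ^ n =
      4 ^ n * (n.factorial : ℝ) ^ 2 / (2 * n + 1).factorial * x ^ (2 * n + 1) := by
  induction n with
  | zero => simp
  | succ n ih =>
    have hderiv : ∀ y : ℝ, HasDerivAt (fun y => y * (x ^ 2 - y ^ 2) ^ (n + 1))
        ((2 * n + 3) * (x ^ 2 - y ^ 2) ^ (n + 1) -
          (2 * n + 2) * x ^ 2 * (x ^ 2 - y ^ 2) ^ n) y := by
      intro y
      have h1 : HasDerivAt (fun y : ℝ => x ^ 2 - y ^ 2) (-(2 * y)) y := by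
        simpa using ((hasDerivAt_id y).pow 2).const_sub (x ^ 2)
      convert! (hasDerivAt_id y).mul (h1.pow (n + 1)) using 1
      simp only [id, Pi.pow_apply, Nat.cast_add, Nat.cast_one, Nat.add_one_sub_one]
      ring
    have hI := intervalIntegral.integral_eq_sub_of_hasDerivAt (a := 0) (b := x)
      (fun y _ => hderiv y) (Continuous.intervalIntegrable (by fun_prop) _ _)
    rw [intervalIntegral.integral_sub (Continuous.intervalIntegrable (by fun_prop) _ _)
      (Continuous.intervalIntegrable (by fun_prop) _ _),
      intervalIntegral.integral_const_mul, intervalIntegral.integral_const_mul, ih] at hI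
    simp only [sub_self, ne_eq, Nat.add_eq_zero_iff, one_ne_zero, and_false, not_false_eq_true,
      zero_pow, mul_zero, zero_mul] at hI
    have h2 : ((2 * (n + 1) + 1).factorial : ℝ) =
        (2 * n + 3) * (2 * n + 2) * (2 * n + 1).factorial := by
      rw [show 2 * (n + 1) + 1 = (2 * n + 1) + 1 + 1 by ring, Nat.factorial_succ,
        Nat.factorial_succ]
      push_cast
      ring
    have h3 : ((n + 1).factorial : ℝ) = (n + 1) * n.factorial := by
      rw [Nat.factorial_succ]
      push_cast
      ring
    have h4 : ((2 * n + 1).factorial : ℝ) ≠ 0 := by positivity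
    have h5 : (2 * n + 3 : ℝ) ≠ 0 := by positivity
    have h6 : (2 * n + 2 : ℝ) ≠ 0 := by positivity
    have h7 : ∫ y in (0 : ℝ)..x, (x ^ 2 - y ^ 2) ^ (n + 1) =
        (2 * n + 2) * x ^ 2 * (4 ^ n * (n.factorial : ℝ) ^ 2 / (2 * n + 1).factorial *
          x ^ (2 * n + 1)) / (2 * n + 3) := by
      rw [eq_div_iff h5]
      linarith
    rw [h7, h2, h3]
    field_simp
    ring

/-- The kernel `q` turns the constant `1` into `cosh`: integrating the Bessel series term by term
gives the series of `cosh(√(a+c) x) - 1`. -/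
theorem integral_abs_kernelQ {a c s x : ℝ} (hs : a + c = s ^ 2) (hx : 0 ≤ x) :
    ∫ y in (0 : ℝ)..x, |kernelQ a c x y| = Real.cosh (s * x) - 1 := by
  have habs : ∀ y ∈ Icc 0 x, |kernelQ a c x y| =
      s ^ 2 * x * besselI1Quot (s ^ 2 * (x ^ 2 - y ^ 2)) := by
    intro y hy
    have h1 : 0 ≤ x ^ 2 - y ^ 2 := by nlinarith [hy.1, hy.2]
    have h2 := besselI1Quot_nonneg (mul_nonneg (sq_nonneg s) h1)
    rw [kernelQ, hs, show -s ^ 2 * x * besselI1Quot (s ^ 2 * (x ^ 2 - y ^ 2)) =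
      -(s ^ 2 * x * besselI1Quot (s ^ 2 * (x ^ 2 - y ^ 2))) by ring, abs_neg, abs_of_nonneg]
    positivity
  have hsum := intervalIntegral.hasSum_integral_of_dominated_convergence (a := 0) (b := x)
    (μ := volume)
    (F := fun (n : ℕ) y => (1 / 2) * (s ^ 2 * (x ^ 2 - y ^ 2) / 4) ^ n /
      ((n.factorial : ℝ) * ((n + 1).factorial : ℝ)))
    (f := fun y => besselI1Quot (s ^ 2 * (x ^ 2 - y ^ 2)))
    (fun n _ => (s ^ 2 * x ^ 2 / 4) ^ n / n.factorial)
    (fun n => (by fun_prop : Continuous _).aestronglyMeasurable)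
    (fun n => .of_forall fun y hy => ?_)
    (.of_forall fun y _ => Real.summable_pow_div_factorial _)
    (by simp)
    (.of_forall fun y _ => (summable_besselI1Quot _).hasSum)
  swap
  · rw [uIoc_of_le hx] at hy
    have h1 : 0 ≤ x ^ 2 - y ^ 2 := by nlinarith [hy.1, hy.2]
    refine norm_besselI1Quot_term_le ?_ n
    rw [abs_of_nonneg (by positivity)]
    nlinarith [mul_nonneg (sq_nonneg s) (sq_nonneg y)]
  have hcosh := (hasSum_nat_add_iff' 1).mpr (Real.hasSum_cosh (s * x))
  simp only [Finset.range_one, Finset.sum_singleton, mul_zero, pow_zero, Nat.factorial_zero,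
    Nat.cast_one, div_one] at hcosh
  rw [intervalIntegral.integral_congr (g := fun y =>
    s ^ 2 * x * besselI1Quot (s ^ 2 * (x ^ 2 - y ^ 2))) (by rwa [uIcc_of_le hx]),
    intervalIntegral.integral_const_mul]
  refine (hsum.mul_left (s ^ 2 * x)).unique ?_
  convert! hcosh using 1
  funext n
  have h1 : ∀ y : ℝ, (1 / 2) * (s ^ 2 * (x ^ 2 - y ^ 2) / 4) ^ n /
      ((n.factorial : ℝ) * ((n + 1).factorial : ℝ)) =
      (1 / 2) * (s ^ 2 / 4) ^ n / ((n.factorial : ℝ) * ((n + 1).factorial : ℝ)) *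
        (x ^ 2 - y ^ 2) ^ n := fun y => by
    rw [show s ^ 2 * (x ^ 2 - y ^ 2) / 4 = s ^ 2 / 4 * (x ^ 2 - y ^ 2) by ring, mul_pow]
    ring
  simp only [h1]
  rw [intervalIntegral.integral_const_mul, integral_sq_sub_sq_pow]
  have h2 : ((2 * (n + 1)).factorial : ℝ) = (2 * n + 2) * (2 * n + 1).factorial := by
    rw [show 2 * (n + 1) = (2 * n + 1) + 1 by ring, Nat.factorial_succ]
    push_cast
    ring
  have h3 : ((n + 1).factorial : ℝ) = (n + 1) * n.factorial := by
    rw [Nat.factorial_succ]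
    push_cast
    ring
  have h4 : ((2 * n + 1).factorial : ℝ) ≠ 0 := by positivity
  have h5 : (n.factorial : ℝ) ≠ 0 := by positivity
  have h6 : (n + 1 : ℝ) ≠ 0 := by positivity
  rw [h2, h3, div_pow]
  field_simp
  ring

open scoped Matrix.Norms.Operator in
theorem continuous_gammaRow {n : ℕ} (A : Matrix (Fin n) (Fin n) ℝ)
    (K : Matrix (Fin 1) (Fin n) ℝ) (a : ℝ) : Continuous (gammaRow A K a) := by
  have h1 : Continuous fun x : ℝ => NormedSpace.exp (x •
      Matrix.fromBlocks (0 : Matrix (Fin n) (Fin n) ℝ)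
        (A - a • (1 : Matrix (Fin n) (Fin n) ℝ)) (1 : Matrix (Fin n) (Fin n) ℝ) 0) :=
    NormedSpace.exp_continuous.comp (by fun_prop)
  exact (continuous_const.matrix_mul h1).matrix_mul continuous_const

/-- The maximum over `[0,1]` of the Euclidean norm of the row vector `γ(x)`. -/
noncomputable def gammaSup {n : ℕ} (A : Matrix (Fin n) (Fin n) ℝ) (K : Matrix (Fin 1) (Fin n) ℝ)
    (a : ℝ) : ℝ :=
  sSup ((fun x : ℝ => Real.sqrt (∑ j, gammaRow A K a x 0 j ^ 2)) '' Icc (0 : ℝ) 1)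

theorem sqrt_gammaRow_le_gammaSup {n : ℕ} (A : Matrix (Fin n) (Fin n) ℝ)
    (K : Matrix (Fin 1) (Fin n) ℝ) (a : ℝ) {x : ℝ} (hx : x ∈ Icc (0 : ℝ) 1) :
    Real.sqrt (∑ j, gammaRow A K a x 0 j ^ 2) ≤ gammaSup A K a := by
  have hγ : ∀ j, Continuous fun x => gammaRow A K a x 0 j := fun j =>
    (continuous_gammaRow A K a).matrix_elem 0 j
  refine le_csSup (isCompact_Icc.bddAbove_image (Continuous.continuousOn ?_))
    (mem_image_of_mem _ hx)
  fun_prop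

theorem gammaSup_nonneg {n : ℕ} (A : Matrix (Fin n) (Fin n) ℝ) (K : Matrix (Fin 1) (Fin n) ℝ)
    (a : ℝ) : 0 ≤ gammaSup A K a :=
  (Real.sqrt_nonneg _).trans (sqrt_gammaRow_le_gammaSup A K a ⟨le_rfl, zero_le_one⟩)

theorem abs_gammaRow_dotProduct_le {n : ℕ} (A : Matrix (Fin n) (Fin n) ℝ)
    (K : Matrix (Fin 1) (Fin n) ℝ) (a : ℝ) (ξ : Fin n → ℝ) {x : ℝ} (hx : x ∈ Icc (0 : ℝ) 1) :
    |gammaRow A K a x 0 ⬝ᵥ ξ| ≤ gammaSup A K a * Real.sqrt (ξ ⬝ᵥ ξ) := by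
  have h1 := Real.abs_le_sqrt (sq_dotProduct_le (gammaRow A K a x 0) ξ)
  rw [Real.sqrt_mul (dotProduct_self_nonneg' _)] at h1
  refine h1.trans (mul_le_mul_of_nonneg_right ?_ (Real.sqrt_nonneg _))
  simpa [dotProduct, sq] using sqrt_gammaRow_le_gammaSup A K a hx

/-- The coupling row is controlled by `max |γ|` and the mass of the kernel `q(x, ·)`. -/
theorem abs_couplingRow_mulVec_le {n : ℕ} (A : Matrix (Fin n) (Fin n) ℝ)
    (K : Matrix (Fin 1) (Fin n) ℝ) (a c : ℝ) (ξ : Fin n → ℝ) {x : ℝ} (hx : x ∈ Icc (0 : ℝ) 1) :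
    |(couplingRow A K a c x *ᵥ ξ) 0| ≤
      gammaSup A K a * Real.sqrt (ξ ⬝ᵥ ξ) * (1 + ∫ y in (0 : ℝ)..x, |kernelQ a c x y|) := by
  have hγ : ∀ j, Continuous fun x => gammaRow A K a x 0 j := fun j =>
    (continuous_gammaRow A K a).matrix_elem 0 j
  have hq : Continuous fun y => kernelQ a c x y :=
    (continuous_kernelQ a c).comp (by fun_prop : Continuous fun y : ℝ => (x, y))
  have hlin : (couplingRow A K a c x *ᵥ ξ) 0 = gammaRow A K a x 0 ⬝ᵥ ξ -
      ∫ y in (0 : ℝ)..x, kernelQ a c x y * (gammaRow A K a y 0 ⬝ᵥ ξ) := by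
    have h1 : ∀ y, kernelQ a c x y * (gammaRow A K a y 0 ⬝ᵥ ξ) =
        ∑ j, kernelQ a c x y * gammaRow A K a y 0 j * ξ j := fun y => by
      simp only [dotProduct, Finset.mul_sum, mul_assoc]
    simp only [h1]
    rw [intervalIntegral.integral_finsetSum
      fun j _ => Continuous.intervalIntegrable (by fun_prop) _ _]
    simp only [intervalIntegral.integral_mul_const, Matrix.mulVec, couplingRow, dotProduct,
      Matrix.of_apply, sub_mul, Finset.sum_sub_distrib]
  have hint : |∫ y in (0 : ℝ)..x, kernelQ a c x y * (gammaRow A K a y 0 ⬝ᵥ ξ)| ≤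
      gammaSup A K a * Real.sqrt (ξ ⬝ᵥ ξ) * ∫ y in (0 : ℝ)..x, |kernelQ a c x y| := by
    rw [← intervalIntegral.integral_const_mul, ← Real.norm_eq_abs]
    refine intervalIntegral.norm_integral_le_of_norm_le hx.1 (.of_forall fun y hy => ?_)
      (Continuous.intervalIntegrable (by fun_prop) _ _)
    rw [norm_mul, Real.norm_eq_abs, Real.norm_eq_abs, mul_comm]
    exact mul_le_mul_of_nonneg_right
      (abs_gammaRow_dotProduct_le A K a ξ ⟨hy.1.le, hy.2.trans hx.2⟩) (abs_nonneg _)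
  rw [hlin, mul_add, mul_one]
  exact (abs_sub _ _).trans (add_le_add (abs_gammaRow_dotProduct_le A K a ξ hx) hint)

theorem sq_couplingRow_mulVec_le_zeta {n : ℕ} (A : Matrix (Fin n) (Fin n) ℝ)
    (K : Matrix (Fin 1) (Fin n) ℝ) (a c : ℝ) (ξ : Fin n → ℝ) {x : ℝ} (hx : x ∈ Icc (0 : ℝ) 1) :
    ((couplingRow A K a c x *ᵥ ξ) 0) ^ 2 ≤ zeta A K a c * (ξ ⬝ᵥ ξ) := by
  set T : Set (ℝ × ℝ) := {p : ℝ × ℝ | 0 ≤ p.2 ∧ p.2 ≤ p.1 ∧ p.1 ≤ 1} with hT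
  have hTc : IsCompact T := by
    have hcl : IsClosed T := by
      refine (isClosed_le continuous_const continuous_snd).inter
        ((isClosed_le continuous_snd continuous_fst).inter
          (isClosed_le continuous_fst continuous_const))
    refine (isCompact_Icc.prod isCompact_Icc : IsCompact
      (Icc (0 : ℝ) 1 ×ˢ Icc (0 : ℝ) 1)).of_isClosed_subset hcl ?_
    rintro ⟨p, q⟩ ⟨h0, h1, h2⟩
    exact ⟨⟨h0.trans h1, h2⟩, ⟨h0, h1.trans h2⟩⟩
  set Q : ℝ := sSup ((fun p : ℝ × ℝ => |kernelQ a c p.1 p.2|) '' T) with hQ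
  have hbdd : BddAbove ((fun p : ℝ × ℝ => |kernelQ a c p.1 p.2|) '' T) :=
    hTc.bddAbove_image (continuous_kernelQ a c).abs.continuousOn
  have hqQ : ∀ y ∈ Icc 0 x, |kernelQ a c x y| ≤ Q := fun y hy =>
    le_csSup hbdd ⟨(x, y), ⟨hy.1, hy.2, hx.2⟩, rfl⟩
  have hQ0 : 0 ≤ Q := (abs_nonneg _).trans (hqQ 0 ⟨le_rfl, hx.1⟩)
  have hq : Continuous fun y => kernelQ a c x y :=
    (continuous_kernelQ a c).comp (by fun_prop : Continuous fun y : ℝ => (x, y))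
  have hint : ∫ y in (0 : ℝ)..x, |kernelQ a c x y| ≤ Q := by
    calc ∫ y in (0 : ℝ)..x, |kernelQ a c x y| ≤ ∫ y in (0 : ℝ)..x, Q :=
          intervalIntegral.integral_mono_on hx.1 (hq.abs.intervalIntegrable _ _) (by simp) hqQ
      _ = x * Q := by simp
      _ ≤ Q := mul_le_of_le_one_left hQ0 hx.2
  have hΓ := gammaSup_nonneg A K a
  have h1 := (abs_couplingRow_mulVec_le A K a c ξ hx).trans
    (mul_le_mul_of_nonneg_left (add_le_add_right hint 1)
      (mul_nonneg hΓ (Real.sqrt_nonneg _)))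
  have h2 := pow_le_pow_left₀ (abs_nonneg _) h1 2
  rw [sq_abs, mul_pow, mul_pow, Real.sq_sqrt (dotProduct_self_nonneg' ξ)] at h2
  refine h2.trans_eq ?_
  rw [zeta, ← hT, ← hQ, gammaSup]
  ring

/-- With `c = s² - a`, the coupling row grows at most like `e^{s x}`, so that the weight
`e^{-(s-1)x}` bounds it independently of `s`. -/
theorem sq_weighted_couplingRow_mulVec_le {n : ℕ} (A : Matrix (Fin n) (Fin n) ℝ)
    (K : Matrix (Fin 1) (Fin n) ℝ) {a c s : ℝ} (hs : 0 ≤ s) (hc : a + c = s ^ 2)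
    (ξ : Fin n → ℝ) {x : ℝ} (hx : x ∈ Icc (0 : ℝ) 1) :
    (Real.exp (-(s - 1) * x) * (couplingRow A K a c x *ᵥ ξ) 0) ^ 2 ≤
      (gammaSup A K a * Real.exp 1) ^ 2 * (ξ ⬝ᵥ ξ) := by
  have hΓ := gammaSup_nonneg A K a
  have h1 := abs_couplingRow_mulVec_le A K a c ξ hx
  rw [integral_abs_kernelQ hc hx.1, add_sub_cancel] at h1
  have hcosh : Real.cosh (s * x) ≤ Real.exp (s * x) := by
    rw [Real.cosh_eq]
    have : Real.exp (-(s * x)) ≤ Real.exp (s * x) :=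
      Real.exp_le_exp.mpr (by nlinarith [mul_nonneg hs hx.1])
    linarith
  have h2 : Real.exp (-(s - 1) * x) * Real.exp (s * x) ≤ Real.exp 1 := by
    rw [← Real.exp_add]
    apply Real.exp_le_exp.mpr
    linarith [hx.2]
  have h3 : |Real.exp (-(s - 1) * x) * (couplingRow A K a c x *ᵥ ξ) 0| ≤
      gammaSup A K a * Real.exp 1 * Real.sqrt (ξ ⬝ᵥ ξ) := by
    rw [abs_mul, Real.abs_exp]
    calc Real.exp (-(s - 1) * x) * |(couplingRow A K a c x *ᵥ ξ) 0|
        ≤ Real.exp (-(s - 1) * x) *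
          (gammaSup A K a * Real.sqrt (ξ ⬝ᵥ ξ) * Real.exp (s * x)) := by
          gcongr
          exact h1.trans (by gcongr)
      _ = gammaSup A K a * Real.sqrt (ξ ⬝ᵥ ξ) *
          (Real.exp (-(s - 1) * x) * Real.exp (s * x)) := by ring
      _ ≤ gammaSup A K a * Real.sqrt (ξ ⬝ᵥ ξ) * Real.exp 1 := by gcongr
      _ = _ := by ring
  have h4 := pow_le_pow_left₀ (abs_nonneg _) h3 2
  rwa [sq_abs, mul_pow _ (Real.sqrt _), Real.sq_sqrt (dotProduct_self_nonneg' ξ)] at h4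

/-! ### Feedback with a prescribed decay rate -/

theorem Controllable.eq_zero_of_forall_dotProduct {n : ℕ} {A : Matrix (Fin n) (Fin n) ℝ}
    {B : Matrix (Fin n) (Fin 1) ℝ} (hAB : Controllable A B) {x : Fin n → ℝ}
    (hx : ∀ k : ℕ, x ⬝ᵥ (A ^ k *ᵥ fun i => B i 0) = 0) : x = 0 := by
  set C : Matrix (Fin n) (Fin n) ℝ := Matrix.of fun (i : Fin n) (k : Fin n) =>
    (A ^ (k : ℕ) * B) i 0 with hC
  have hrank : C.rank = n := hAB
  have hli : LinearIndependent ℝ C.row := by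
    rw [linearIndependent_iff_card_eq_finrank_span, Set.finrank, ← Matrix.rank_eq_finrank_span_row,
      hrank, Fintype.card_fin]
  have hinj := Matrix.vecMul_injective_iff.mpr hli
  apply hinj
  funext k
  simpa [hC, Matrix.vecMul, dotProduct, Matrix.mulVec, Matrix.mul_apply] using hx k

open scoped Matrix.Norms.Operator in
theorem hasDerivAt_exp_smul_mulVec {n : ℕ} (N : Matrix (Fin n) (Fin n) ℝ) (v : Fin n → ℝ)
    (s : ℝ) : HasDerivAt (fun s : ℝ => NormedSpace.exp (s • N) *ᵥ v)
      (N *ᵥ (NormedSpace.exp (s • N) *ᵥ v)) s := by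
  have h1 := hasDerivAt_exp_smul_const' (𝕂 := ℝ) N s
  rw [Matrix.mulVec_mulVec]
  exact ((LinearMap.toContinuousLinearMap
    ((Matrix.mulVecBilin ℝ ℝ).flip v)).hasFDerivAt.comp_hasDerivAt s h1)

/-- For a controllable pair, the Gramian `W = ∫₀¹ b bᵀ` of `b(s) = e^{-s(A + σ)} B` is positive
definite and `(A + σ) W + W (A + σ)ᵀ = B Bᵀ - b(1) b(1)ᵀ`. Hence `P = W⁻¹` and the feedback
`K = -Bᵀ W⁻¹` give a Lyapunov function that decays at the rate `2σ`. -/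
theorem Controllable.exists_feedback {n : ℕ} {A : Matrix (Fin n) (Fin n) ℝ}
    {B : Matrix (Fin n) (Fin 1) ℝ} (hAB : Controllable A B) (σ : ℝ) :
    ∃ (K : Matrix (Fin 1) (Fin n) ℝ) (P : Matrix (Fin n) (Fin n) ℝ), P.PosDef ∧
      ∀ x : Fin n → ℝ,
        2 * (x ⬝ᵥ (P *ᵥ ((A + B * K) *ᵥ x))) ≤ -(2 * σ) * (x ⬝ᵥ (P *ᵥ x)) := by
  set N : Matrix (Fin n) (Fin n) ℝ := -(A + σ • (1 : Matrix (Fin n) (Fin n) ℝ)) with hN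
  set β : Fin n → ℝ := fun i => B i 0 with hβ
  set b : ℝ → Fin n → ℝ := fun s => NormedSpace.exp (s • N) *ᵥ β with hb
  have hNv : ∀ v : Fin n → ℝ, N *ᵥ v = -(A *ᵥ v) - σ • v := fun v => by
    rw [hN, Matrix.neg_mulVec, Matrix.add_mulVec, Matrix.smul_mulVec, Matrix.one_mulVec]
    abel
  have hb0 : b 0 = β := by simp [hb]
  have hbd : ∀ s, HasDerivAt b (N *ᵥ b s) s := hasDerivAt_exp_smul_mulVec N β
  have hdot : ∀ (p : Fin n → ℝ) s, HasDerivAt (fun s => p ⬝ᵥ b s) (p ⬝ᵥ (N *ᵥ b s)) s := by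
    intro p s
    simp only [dotProduct]
    exact HasDerivAt.fun_sum fun i _ => ((hasDerivAt_pi.mp (hbd s)) i).const_mul (p i)
  have hbc : ∀ i, Continuous fun s => b s i := fun i =>
    continuous_iff_continuousAt.mpr fun s => ((hasDerivAt_pi.mp (hbd s)) i).continuousAt
  have hdotc : ∀ p : Fin n → ℝ, Continuous fun s => p ⬝ᵥ b s := fun p =>
    continuous_iff_continuousAt.mpr fun s => (hdot p s).continuousAt
  set W : Matrix (Fin n) (Fin n) ℝ := Matrix.of fun i j => ∫ s in (0 : ℝ)..1, b s i * b s j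
    with hW
  have hWpq : ∀ p q : Fin n → ℝ,
      p ⬝ᵥ (W *ᵥ q) = ∫ s in (0 : ℝ)..1, (p ⬝ᵥ b s) * (q ⬝ᵥ b s) := by
    intro p q
    have h1 : ∀ s, (p ⬝ᵥ b s) * (q ⬝ᵥ b s) = ∑ i, ∑ j, p i * (b s i * b s j * q j) := fun s => by
      simp only [dotProduct, Finset.sum_mul_sum]
      refine Finset.sum_congr rfl fun i _ => Finset.sum_congr rfl fun j _ => ?_
      ring
    simp only [h1]
    rw [intervalIntegral.integral_finsetSum
      fun i _ => Continuous.intervalIntegrable (by fun_prop) _ _]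
    simp only [dotProduct, Matrix.mulVec, Finset.mul_sum]
    refine Finset.sum_congr rfl fun i _ => ?_
    rw [intervalIntegral.integral_finsetSum
      fun j _ => Continuous.intervalIntegrable (by fun_prop) _ _]
    simp [hW]
  -- if `xᵀ W x = 0`, then `xᵀ b` and all its derivatives vanish, so `x` is orthogonal to `Aᵏ B`
  have hWpos : W.PosDef := by
    refine Matrix.PosDef.of_dotProduct_mulVec_pos ?_ fun x hx => ?_
    · ext i j
      simp [hW, mul_comm]
    rw [star_trivial, hWpq]
    have hnn : ∀ s, 0 ≤ (x ⬝ᵥ b s) * (x ⬝ᵥ b s) := fun s => mul_self_nonneg _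
    refine lt_of_le_of_ne (intervalIntegral.integral_nonneg zero_le_one fun s _ => hnn s) ?_
    intro h0
    apply hx
    have hzero : ∀ s ∈ Icc (0 : ℝ) 1, x ⬝ᵥ b s = 0 := by
      intro s hs
      by_contra hne
      have hc : ContinuousOn (fun s => (x ⬝ᵥ b s) * (x ⬝ᵥ b s)) (Icc 0 1) :=
        ((hdotc x).mul (hdotc x)).continuousOn
      exact (intervalIntegral.integral_pos zero_lt_one hc (fun s _ => hnn s)
        ⟨s, hs, mul_self_pos.mpr hne⟩).ne h0
    have hall : ∀ k : ℕ, ∀ s ∈ Ioo (0 : ℝ) 1, x ⬝ᵥ (A ^ k *ᵥ b s) = 0 := by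
      intro k
      induction k with
      | zero => intro s hs; simpa using hzero s (Ioo_subset_Icc_self hs)
      | succ k ih =>
        intro s hs
        have h1 := hdot (x ᵥ* A ^ k) s
        have h2 : HasDerivAt (fun s => (x ᵥ* A ^ k) ⬝ᵥ b s) 0 s := by
          refine (hasDerivAt_const s (0 : ℝ)).congr_of_eventuallyEq ?_
          filter_upwards [Ioo_mem_nhds hs.1 hs.2] with r hr
          rw [← Matrix.dotProduct_mulVec, ih r hr]
        have h3 := h1.unique h2
        rw [hNv, ← Matrix.dotProduct_mulVec, Matrix.mulVec_sub, Matrix.mulVec_neg,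
          Matrix.mulVec_smul, dotProduct_sub, dotProduct_neg, dotProduct_smul, ih s hs,
          Matrix.mulVec_mulVec, ← pow_succ] at h3
        simpa using h3
    refine hAB.eq_zero_of_forall_dotProduct fun k => ?_
    have hEq : EqOn (fun s => (x ᵥ* A ^ k) ⬝ᵥ b s) (fun _ => 0) (Ioo 0 1) := fun s hs => by
      simp only
      rw [← Matrix.dotProduct_mulVec, hall k s hs]
    have h0 := hEq.closure (hdotc _) continuous_const
      (by rw [closure_Ioo zero_ne_one]; exact ⟨le_rfl, zero_le_one⟩ : (0 : ℝ) ∈ closure (Ioo 0 1))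
    simp only [hb0] at h0
    rwa [← Matrix.dotProduct_mulVec] at h0
  have hu : IsUnit W.det := (Matrix.isUnit_iff_isUnit_det W).mp hWpos.isUnit
  refine ⟨-(Bᵀ * W⁻¹), W⁻¹, hWpos.inv, fun x => ?_⟩
  set y : Fin n → ℝ := W⁻¹ *ᵥ x with hy
  have hWy : W *ᵥ y = x := by
    rw [hy, Matrix.mulVec_mulVec, Matrix.mul_nonsing_inv _ hu, Matrix.one_mulVec]
  have hsymm : ∀ v : Fin n → ℝ, x ⬝ᵥ (W⁻¹ *ᵥ v) = y ⬝ᵥ v := fun v => by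
    have hT : (W⁻¹)ᵀ = W⁻¹ := by simpa [Matrix.IsHermitian] using hWpos.inv.isHermitian
    rw [Matrix.dotProduct_mulVec, ← Matrix.mulVec_transpose, hT]
  have hBK : (B * -(Bᵀ * W⁻¹)) *ᵥ x = -(y ⬝ᵥ β) • β := by
    rw [Matrix.mul_neg, Matrix.neg_mulVec, ← Matrix.mulVec_mulVec, ← Matrix.mulVec_mulVec, ← hy]
    funext i
    simp only [Matrix.mulVec, dotProduct, hβ, Pi.neg_apply, Pi.smul_apply, smul_eq_mul,
      Finset.univ_unique, Finset.sum_singleton, Matrix.transpose_apply, Fin.default_eq_zero,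
      mul_comm]
    ring
  have hA : y ⬝ᵥ (A *ᵥ x) = ∫ s in (0 : ℝ)..1, (y ⬝ᵥ (A *ᵥ b s)) * (y ⬝ᵥ b s) := by
    rw [← hWy, Matrix.dotProduct_mulVec, hWpq]
    simp only [Matrix.dotProduct_mulVec]
  have hxy : x ⬝ᵥ (W⁻¹ *ᵥ x) = ∫ s in (0 : ℝ)..1, (y ⬝ᵥ b s) * (y ⬝ᵥ b s) := by
    rw [hsymm, ← hWpq, hWy]
  have hAc : Continuous fun s => y ⬝ᵥ (A *ᵥ b s) := by
    simp only [Matrix.dotProduct_mulVec]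
    exact hdotc _
  have hyc := hdotc y
  have hFTC : ∫ s in (0 : ℝ)..1, (-2 * ((y ⬝ᵥ (A *ᵥ b s)) * (y ⬝ᵥ b s)) -
      2 * σ * ((y ⬝ᵥ b s) * (y ⬝ᵥ b s))) = (y ⬝ᵥ b 1) ^ 2 - (y ⬝ᵥ b 0) ^ 2 := by
    refine intervalIntegral.integral_eq_sub_of_hasDerivAt (f := fun s => (y ⬝ᵥ b s) ^ 2)
      (fun s _ => ?_) (Continuous.intervalIntegrable (by fun_prop) _ _)
    refine ((hdot y s).fun_pow 2).congr_deriv ?_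
    rw [hNv, dotProduct_sub, dotProduct_neg, dotProduct_smul, smul_eq_mul]
    push_cast
    ring
  rw [intervalIntegral.integral_sub (Continuous.intervalIntegrable (by fun_prop) _ _)
    (Continuous.intervalIntegrable (by fun_prop) _ _), intervalIntegral.integral_const_mul,
    intervalIntegral.integral_const_mul, ← hA, ← hxy, hb0] at hFTC
  rw [hsymm, Matrix.add_mulVec, hBK, dotProduct_add, dotProduct_smul, smul_eq_mul]
  nlinarith [sq_nonneg (y ⬝ᵥ b 1), sq_nonneg (y ⬝ᵥ β)]

/-! ### The weighted Lyapunov functional -/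

/-- The bilinear form `(f, g) ↦ ∫₀¹ e^{-2μx} f g dx` on `L²(0,1)`. -/
noncomputable def weightedInner (μ : ℝ) (f g : L2unit) : ℝ :=
  ∫ x, Real.exp (-(2 * μ) * x) * (f x * g x) ∂unitMeasure

theorem memLp_top_exp (d : ℝ) : MemLp (fun x : ℝ => Real.exp (d * x)) ⊤ unitMeasure := by
  refine memLp_top_of_bound (Continuous.aestronglyMeasurable (by fun_prop)) (Real.exp |d|) ?_
  filter_upwards [ae_restrict_mem measurableSet_Ioo] with x hx
  rw [Real.norm_eq_abs, Real.abs_exp]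
  apply Real.exp_le_exp.mpr
  calc d * x ≤ |d| * x := mul_le_mul_of_nonneg_right (le_abs_self d) hx.1.le
    _ ≤ |d| := mul_le_of_le_one_right (abs_nonneg d) hx.2.le

/-- Multiplication by `x ↦ e^{dx}` on `L²(0,1)`. -/
noncomputable def expMul (d : ℝ) : L2unit →L[ℝ] L2unit :=
  (ContinuousLinearMap.mul ℝ ℝ).holderL unitMeasure ⊤ 2 2 ((memLp_top_exp d).toLp _)

theorem coeFn_expMul (d : ℝ) (f : L2unit) :
    expMul d f =ᵐ[unitMeasure] fun x => Real.exp (d * x) * f x := by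
  filter_upwards [(ContinuousLinearMap.mul ℝ ℝ).coeFn_holder (r := 2)
    ((memLp_top_exp d).toLp _) f, (memLp_top_exp d).coeFn_toLp] with x h1 h2
  rw [h2] at h1
  exact h1

theorem weightedInner_eq_inner (μ : ℝ) (f g : L2unit) :
    weightedInner μ f g = inner ℝ (expMul (-(2 * μ)) f) g := by
  rw [L2.inner_def, weightedInner]
  refine integral_congr_ae ?_
  filter_upwards [coeFn_expMul (-(2 * μ)) f] with x hx
  rw [hx]
  simp only [RCLike.inner_apply, conj_trivial]
  ring

theorem integrable_weighted (μ : ℝ) (f g : L2unit) :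
    Integrable (fun x => Real.exp (-(2 * μ) * x) * (f x * g x)) unitMeasure := by
  refine (L2.integrable_inner (𝕜 := ℝ) (expMul (-(2 * μ)) f) g).congr ?_
  filter_upwards [coeFn_expMul (-(2 * μ)) f] with x hx
  rw [hx]
  simp only [RCLike.inner_apply, conj_trivial]
  ring

theorem weightedInner_comm (μ : ℝ) (f g : L2unit) : weightedInner μ f g = weightedInner μ g f := by
  simp only [weightedInner, mul_comm]

theorem weightedInner_self (μ : ℝ) (f : L2unit) :
    weightedInner μ f f = ∫ x, Real.exp (-(2 * μ) * x) * f x ^ 2 ∂unitMeasure := by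
  simp only [weightedInner, sq]

theorem weightedInner_self_nonneg (μ : ℝ) (f : L2unit) : 0 ≤ weightedInner μ f f :=
  integral_nonneg fun _ => mul_nonneg (Real.exp_pos _).le (mul_self_nonneg _)

/-- Young's inequality for the weighted inner product. -/
theorem neg_two_mul_weightedInner_le (μ : ℝ) {r : ℝ} (hr : 0 < r) (f g : L2unit) :
    -2 * weightedInner μ f g ≤ r * weightedInner μ f f + r⁻¹ * weightedInner μ g g := by
  have h := weightedInner_self_nonneg μ (r • f + g)
  have hc := weightedInner_comm μ g f
  simp only [weightedInner_eq_inner, map_add, map_smul, inner_add_left, inner_add_right,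
    real_inner_smul_left, real_inner_smul_right] at h hc ⊢
  rw [hc] at h
  have h2 := mul_nonneg (inv_pos.mpr hr).le h
  have h3 : r⁻¹ * r = 1 := inv_mul_cancel₀ hr.ne'
  linear_combination h2 + (r * inner ℝ (expMul (-(2 * μ)) f) f +
    2 * inner ℝ (expMul (-(2 * μ)) f) g) * h3

/-- A nonpositive binary quadratic form, applied pointwise to two functions, has a nonpositive
weighted integral. -/
theorem weightedInner_quadForm_nonpos (μ : ℝ) {α β γ : ℝ}
    (hq : ∀ p q : ℝ, α * p ^ 2 + 2 * β * (p * q) + γ * q ^ 2 ≤ 0) (f g : L2unit) :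
    α * weightedInner μ f f + 2 * β * weightedInner μ f g + γ * weightedInner μ g g ≤ 0 := by
  have h : α * weightedInner μ f f + 2 * β * weightedInner μ f g + γ * weightedInner μ g g =
      ∫ x, Real.exp (-(2 * μ) * x) *
        (α * f x ^ 2 + 2 * β * (f x * g x) + γ * g x ^ 2) ∂unitMeasure := by
    simp only [weightedInner]
    rw [← integral_const_mul, ← integral_const_mul, ← integral_const_mul, ← integral_add,
      ← integral_add]
    · refine integral_congr_ae (.of_forall fun x => ?_)
      ring
    · exact ((integrable_weighted μ f f).const_mul _).add ((integrable_weighted μ f g).const_mul _)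
    · exact (integrable_weighted μ g g).const_mul _
    · exact (integrable_weighted μ f f).const_mul _
    · exact (integrable_weighted μ f g).const_mul _
  rw [h]
  exact integral_nonpos fun x => mul_nonpos_of_nonneg_of_nonpos (Real.exp_pos _).le (hq _ _)

theorem hasDerivWithinAt_weightedInner_self (μ : ℝ) {z : ℝ → L2unit} {z' : L2unit} {S : Set ℝ}
    {t : ℝ} (hz : HasDerivWithinAt z z' S t) :
    HasDerivWithinAt (fun t => weightedInner μ (z t) (z t)) (2 * weightedInner μ (z t) z') S t := by
  have h1 := ((expMul (-(2 * μ))).hasFDerivAt.comp_hasDerivWithinAt t hz).inner ℝ hz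
  simp only [weightedInner_eq_inner]
  refine h1.congr_deriv ?_
  have := weightedInner_comm μ z' (z t)
  simp only [weightedInner_eq_inner] at this
  simp only [Function.comp_apply, this]
  ring

/-- The functional `X(t)ᵀ P X(t) + p₁ ∫₀¹ e^{-2μx} z(x,t)² dx`; the weight `μ = 0` gives
`lyapunovV`. -/
noncomputable def weightedV {n : ℕ} (P : Matrix (Fin n) (Fin n) ℝ) (p₁ μ : ℝ)
    (X : ℝ → Fin n → ℝ) (z : ℝ → L2unit) (t : ℝ) : ℝ :=
  X t ⬝ᵥ (P *ᵥ X t) + p₁ * weightedInner μ (z t) (z t)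

theorem weightedV_zero {n : ℕ} (P : Matrix (Fin n) (Fin n) ℝ) (p₁ : ℝ)
    (X : ℝ → Fin n → ℝ) (z : ℝ → L2unit) : weightedV P p₁ 0 X z = lyapunovV P p₁ X z := by
  funext t
  simp [weightedV, lyapunovV, weightedInner_self]

theorem weightedV_nonneg {n : ℕ} {P : Matrix (Fin n) (Fin n) ℝ} (hP : P.PosDef) {p₁ : ℝ}
    (hp : 0 ≤ p₁) (μ : ℝ) (X : ℝ → Fin n → ℝ) (z : ℝ → L2unit) (t : ℝ) :
    0 ≤ weightedV P p₁ μ X z t :=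
  add_nonneg (by simpa using hP.posSemidef.dotProduct_mulVec_nonneg (X t))
    (mul_nonneg hp (weightedInner_self_nonneg μ _))

theorem hasDerivWithinAt_quadForm {n : ℕ} {P : Matrix (Fin n) (Fin n) ℝ} (hP : P.PosDef)
    {X : ℝ → Fin n → ℝ} {X' : Fin n → ℝ} {S : Set ℝ} {t : ℝ} (hX : HasDerivWithinAt X X' S t) :
    HasDerivWithinAt (fun t => X t ⬝ᵥ (P *ᵥ X t)) (2 * (X t ⬝ᵥ (P *ᵥ X'))) S t := by
  have hi := hasDerivWithinAt_pi.mp hX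
  have h1 : HasDerivWithinAt (fun t => X t ⬝ᵥ (P *ᵥ X t))
      (X' ⬝ᵥ (P *ᵥ X t) + X t ⬝ᵥ (P *ᵥ X')) S t := by
    simp only [dotProduct, Matrix.mulVec, ← Finset.sum_add_distrib]
    refine HasDerivWithinAt.fun_sum fun i _ => (hi i).mul ?_
    exact HasDerivWithinAt.fun_sum fun j _ => (hi j).const_mul (P i j)
  refine h1.congr_deriv ?_
  rw [hP.dotProduct_mulVec_comm X' (X t)]
  ring

/-- The hypotheses under which the weighted functional decays: the quadratic forms of `Θ₁` and
`Θ₂` are nonpositive when `ζ` is replaced by a bound `Z` for the square of the weighted coupling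
row, and `c` by `c - μ²`. -/
structure WeightedLMI {n : ℕ} (A A₁ : Matrix (Fin n) (Fin n) ℝ) (B : Matrix (Fin n) (Fin 1) ℝ)
    (a a₂ : ℝ) (K : Matrix (Fin 1) (Fin n) ℝ) (c μ Z r : ℝ) (P : Matrix (Fin n) (Fin n) ℝ)
    (p₁ lam δ₀ δ₁ : ℝ) : Prop where
  r_pos : 0 < r
  p₁_pos : 0 < p₁
  lam_nonneg : 0 ≤ lam
  lam_le : lam ≤ 2 * p₁
  posDef : P.PosDef
  coupling : ∀ (ξ : Fin n → ℝ), ∀ x ∈ Icc (0 : ℝ) 1,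
    (Real.exp (-μ * x) * (couplingRow A K a c x *ᵥ ξ) 0) ^ 2 ≤ Z * (ξ ⬝ᵥ ξ)
  theta₁ : ∀ (x y : Fin n → ℝ) (s : ℝ),
    2 * (x ⬝ᵥ (P *ᵥ ((A + B * K) *ᵥ x + A₁ *ᵥ y + B *ᵥ (fun _ => s)))) +
      2 * δ₀ * (x ⬝ᵥ (P *ᵥ x)) - 2 * δ₁ * (y ⬝ᵥ (P *ᵥ y)) +
      p₁ * r⁻¹ * (Z * (((A₁ - a₂ • (1 : Matrix (Fin n) (Fin n) ℝ)) *ᵥ y) ⬝ᵥ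
        ((A₁ - a₂ • (1 : Matrix (Fin n) (Fin n) ℝ)) *ᵥ y))) - lam * s ^ 2 ≤ 0
  theta₂ : ∀ p q : ℝ,
    ((-2 * (c - μ ^ 2) + 2 * δ₀ + r - Real.pi ^ 2 / 2) * p₁ + Real.pi ^ 2 / 4 * lam) * p ^ 2 +
      2 * (a₂ * p₁) * (p * q) + -2 * δ₁ * p₁ * q ^ 2 ≤ 0

section

variable {n : ℕ} {A A₁ : Matrix (Fin n) (Fin n) ℝ} {B : Matrix (Fin n) (Fin 1) ℝ}
  {a a₂ : ℝ} {K : Matrix (Fin 1) (Fin n) ℝ} {c μ Z r : ℝ} {P : Matrix (Fin n) (Fin n) ℝ}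
  {p₁ lam δ₀ δ₁ h : ℝ} {τ : ℝ → ℝ} {f X : ℝ → Fin n → ℝ} {φ z : ℝ → L2unit}

/-- Along a solution, `V' ≤ -2δ₀ V + 2δ₁ V(t - τ(t))`. -/
theorem WeightedLMI.exists_hasDerivWithinAt
    (hL : WeightedLMI A A₁ B a a₂ K c μ Z r P p₁ lam δ₀ δ₁)
    (hsol : IsClassicalSolution A A₁ B a a₂ K c h τ f φ X z) {t : ℝ} (ht : 0 ≤ t) :
    ∃ V', HasDerivWithinAt (weightedV P p₁ μ X z) V' (Ici 0) t ∧
      V' ≤ -2 * δ₀ * weightedV P p₁ μ X z t + 2 * δ₁ * weightedV P p₁ μ X z (t - τ t) := by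
  obtain ⟨-, u, w, ⟨-, -, -, hdom⟩, heq⟩ := hsol
  obtain ⟨hX, zt, hz, hzt⟩ := heq t ht
  have hp := hL.p₁_pos
  refine ⟨_, (hasDerivWithinAt_quadForm hL.posDef hX).add
    ((hasDerivWithinAt_weightedInner_self μ hz).const_mul p₁), ?_⟩
  set ξ : Fin n → ℝ := (A₁ - a₂ • (1 : Matrix (Fin n) (Fin n) ℝ)) *ᵥ X (t - τ t) with hξ
  -- `g` is the coupling term, as an element of `L²(0,1)`
  set g : L2unit := w t - c • z t + a₂ • z (t - τ t) - zt with hg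
  have hgx : ∀ᵐ x ∂unitMeasure, g x = (couplingRow A K a c x *ᵥ ξ) 0 := by
    filter_upwards [hzt, Lp.coeFn_sub (w t - c • z t + a₂ • z (t - τ t)) zt,
      Lp.coeFn_add (w t - c • z t) (a₂ • z (t - τ t)), Lp.coeFn_sub (w t) (c • z t),
      Lp.coeFn_smul c (z t), Lp.coeFn_smul a₂ (z (t - τ t))] with x h0 h1 h2 h3 h4 h5
    simp only [Pi.sub_apply, Pi.add_apply, Pi.smul_apply, smul_eq_mul] at h1 h2 h3 h4 h5
    rw [hg, h1, h2, h3, h4, h5, h0]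
    ring
  have hgZ : weightedInner μ g g ≤ Z * (ξ ⬝ᵥ ξ) := by
    have h1 : weightedInner μ g g ≤ ∫ _, Z * (ξ ⬝ᵥ ξ) ∂unitMeasure := by
      refine integral_mono_ae (integrable_weighted μ g g) (integrable_const _) ?_
      filter_upwards [hgx, ae_restrict_mem measurableSet_Ioo] with x hx hx01
      have h2 := hL.coupling ξ x (Ioo_subset_Icc_self hx01)
      rw [← hx, mul_pow, ← Real.exp_nat_mul] at h2
      convert! h2 using 2
      · push_cast
        ring_nf
      · ring
    simpa using h1
  have hzt' : zt = w t - c • z t + a₂ • z (t - τ t) - g := by rw [hg]; abel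
  have hexpand : weightedInner μ (z t) zt = weightedInner μ (z t) (w t) -
      c * weightedInner μ (z t) (z t) + a₂ * weightedInner μ (z t) (z (t - τ t)) -
      weightedInner μ (z t) g := by
    rw [hzt']
    simp only [weightedInner_eq_inner, inner_sub_right, inner_add_right, real_inner_smul_right]
  have henergy := (hdom t ht).weighted_energy_le μ hL.lam_nonneg hL.lam_le
  rw [← weightedInner_self] at henergy
  have hyoung := mul_le_mul_of_nonneg_left
    (neg_two_mul_weightedInner_le μ hL.r_pos (z t) g) hp.le
  have hgZ' := mul_le_mul_of_nonneg_left hgZ (mul_pos hp (inv_pos.mpr hL.r_pos)).le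
  have h1 := hL.theta₁ (X t) (X (t - τ t)) (u t 0)
  have h2 := weightedInner_quadForm_nonpos μ hL.theta₂ (z t) (z (t - τ t))
  rw [← hξ] at h1
  change 2 * p₁ * weightedInner μ (z t) (w t) + _ ≤ _ at henergy
  rw [hexpand]
  simp only [weightedV]
  linarith

theorem RegularPath.continuousOn_weightedV {S : Set ℝ} {u : ℝ → ℝ → ℝ} {w : ℝ → L2unit}
    (hreg : RegularPath S f φ u w) (P : Matrix (Fin n) (Fin n) ℝ) (p₁ μ : ℝ) :
    ContinuousOn (weightedV P p₁ μ f φ) S := by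
  obtain ⟨hf, hφ, -, -⟩ := hreg
  have h1 := (continuous_quadForm P).comp_continuousOn hf.continuousOn
  have h2 : ContinuousOn (fun t => weightedInner μ (φ t) (φ t)) S := by
    simp only [weightedInner_eq_inner]
    exact ((expMul (-(2 * μ))).continuous.comp_continuousOn hφ.continuousOn).inner
      hφ.continuousOn
  exact h1.add (continuousOn_const.mul h2)

theorem bddAbove_weightedV_initial (hinit : InitialClass h f φ)
    (hsol : IsClassicalSolution A A₁ B a a₂ K c h τ f φ X z) (P : Matrix (Fin n) (Fin n) ℝ)
    (p₁ μ : ℝ) : BddAbove (weightedV P p₁ μ X z '' Icc (-h) 0) := by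
  obtain ⟨u, w, hreg⟩ := hinit
  have h1 := isCompact_Icc.bddAbove_image (hreg.continuousOn_weightedV P p₁ μ)
  have h2 : EqOn (weightedV P p₁ μ X z) (weightedV P p₁ μ f φ) (Icc (-h) 0) := fun θ hθ => by
    simp only [weightedV, (hsol.1 θ hθ).1, (hsol.1 θ hθ).2]
  rwa [h2.image_eq]

/-- Under the matrix inequalities, Halanay's inequality gives the decay of the weighted
functional. -/
theorem WeightedLMI.weightedV_le {h₀ δ : ℝ}
    (hL : WeightedLMI A A₁ B a a₂ K c μ Z r P p₁ lam δ₀ δ₁)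
    (hδ : 0 ≤ δ) (hδ₁ : 0 ≤ δ₁) (hrate : δ = δ₀ - δ₁ * Real.exp (2 * δ * h))
    (hτ : IsDelay h₀ h τ) (hinit : InitialClass h f φ)
    (hsol : IsClassicalSolution A A₁ B a a₂ K c h τ f φ X z) {t : ℝ} (ht : 0 ≤ t) :
    weightedV P p₁ μ X z t ≤
      Real.exp (-2 * δ * t) * sSup (weightedV P p₁ μ X z '' Icc (-h) 0) := by
  choose! V' hV' hineq using fun t (ht : 0 ≤ t) => hL.exists_hasDerivWithinAt hsol ht
  have hbdd := bddAbove_weightedV_initial hinit hsol P p₁ μ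
  refine halanay hτ.1 hτ.2.2 ?_ hδ hδ₁ hrate
    (fun θ hθ => le_csSup hbdd (mem_image_of_mem _ hθ)) hV' hineq t ht
  exact Real.sSup_nonneg <| forall_mem_image.mpr fun θ _ =>
    weightedV_nonneg hL.posDef hL.p₁_pos.le μ X z θ

end

/-! ### From the matrix inequalities to decay -/

theorem dotProduct_Theta1_mulVec {n : ℕ} (A A₁ : Matrix (Fin n) (Fin n) ℝ)
    (B : Matrix (Fin n) (Fin 1) ℝ) (a a₂ : ℝ) (K : Matrix (Fin 1) (Fin n) ℝ) (c r : ℝ)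
    {P : Matrix (Fin n) (Fin n) ℝ} (hP : P.PosDef) (p₁ lam δ₀ δ₁ : ℝ)
    (x y : Fin n → ℝ) (s : ℝ) :
    Sum.elim (Sum.elim x y) (fun _ : Fin 1 => s) ⬝ᵥ
      (Theta1 A A₁ B a a₂ K c r P p₁ lam δ₀ δ₁ *ᵥ Sum.elim (Sum.elim x y) (fun _ => s)) =
    2 * (x ⬝ᵥ (P *ᵥ ((A + B * K) *ᵥ x + A₁ *ᵥ y + B *ᵥ (fun _ => s)))) +
      2 * δ₀ * (x ⬝ᵥ (P *ᵥ x)) - 2 * δ₁ * (y ⬝ᵥ (P *ᵥ y)) +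
      p₁ * r⁻¹ * (zeta A K a c * (((A₁ - a₂ • (1 : Matrix (Fin n) (Fin n) ℝ)) *ᵥ y) ⬝ᵥ
        ((A₁ - a₂ • (1 : Matrix (Fin n) (Fin n) ℝ)) *ᵥ y))) - lam * s ^ 2 := by
  have hT : ∀ {m k : ℕ} (M : Matrix (Fin m) (Fin k) ℝ) (v : Fin k → ℝ) (u : Fin m → ℝ),
      v ⬝ᵥ (Mᵀ *ᵥ u) = u ⬝ᵥ (M *ᵥ v) := fun M v u => by
    rw [Matrix.mulVec_transpose, dotProduct_comm, ← Matrix.dotProduct_mulVec]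
  have hs : ((fun _ => s : Fin 1 → ℝ) ⬝ᵥ fun _ => s) = s ^ 2 := by
    simp [dotProduct, sq]
  have hPs : ∀ v, (P *ᵥ x) ⬝ᵥ v = x ⬝ᵥ (P *ᵥ v) := fun v => by
    rw [dotProduct_comm, hP.dotProduct_mulVec_comm]
  have hz : Matrix.fromRows (P * B) (0 : Matrix (Fin n) (Fin 1) ℝ) *ᵥ (fun _ => s) =
      Sum.elim (P *ᵥ (B *ᵥ fun _ => s)) 0 := by
    rw [Matrix.fromRows_mulVec, Matrix.zero_mulVec, Matrix.mulVec_mulVec]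
  have hzT : (Matrix.fromRows (P * B) (0 : Matrix (Fin n) (Fin 1) ℝ))ᵀ *ᵥ Sum.elim x y =
      (P * B)ᵀ *ᵥ x := by
    rw [Matrix.transpose_fromRows, Matrix.fromCols_mulVec]
    simp
  rw [Theta1, Xi, Rmat, Matrix.add_mulVec, Matrix.smul_mulVec, dotProduct_add, dotProduct_smul]
  simp only [Matrix.fromBlocks_mulVec, Sum.elim_comp_inl, Sum.elim_comp_inr,
    sumElim_dotProduct_sumElim, hz, hzT]
  simp only [Matrix.add_mulVec, Matrix.smul_mulVec, Matrix.neg_mulVec, Matrix.zero_mulVec,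
    Matrix.one_mulVec, dotProduct_add, dotProduct_smul, dotProduct_zero,
    Matrix.mulVec_add, neg_smul, dotProduct_neg, hT, hPs, sumElim_dotProduct_sumElim, smul_eq_mul,
    ← Matrix.mulVec_mulVec, hs, add_zero, zero_add]
  ring

theorem dotProduct_Theta2_mulVec (a₂ c r p₁ lam δ₀ δ₁ p q : ℝ) :
    ![p, q] ⬝ᵥ (Theta2 a₂ c r p₁ lam δ₀ δ₁ *ᵥ ![p, q]) =
      ((-2 * c + 2 * δ₀ + r - Real.pi ^ 2 / 2) * p₁ + Real.pi ^ 2 / 4 * lam) * p ^ 2 +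
        2 * (a₂ * p₁) * (p * q) + -2 * δ₁ * p₁ * q ^ 2 := by
  simp [Theta2, dotProduct, Matrix.mulVec, Fin.sum_univ_two]
  ring

theorem NegDef.exists_quadForm_le {ι : Type*} [Fintype ι] {M : Matrix ι ι ℝ} (hM : NegDef M) :
    ∃ κ : ℝ, 0 < κ ∧ ∀ x : ι → ℝ, x ⬝ᵥ (M *ᵥ x) ≤ -κ * (x ⬝ᵥ x) := by
  obtain ⟨κ, hκ, h⟩ := Matrix.PosDef.exists_le_quadForm hM
  refine ⟨κ, hκ, fun x => ?_⟩
  have := h x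
  rw [Matrix.neg_mulVec, dotProduct_neg] at this
  linarith

/-- Strict matrix inequalities persist when `δ₀` is slightly increased. -/
theorem WeightedLMI.exists_of_negDef {n : ℕ} {A A₁ : Matrix (Fin n) (Fin n) ℝ}
    {B : Matrix (Fin n) (Fin 1) ℝ} {a a₂ : ℝ} {K : Matrix (Fin 1) (Fin n) ℝ} {c r : ℝ}
    {P : Matrix (Fin n) (Fin n) ℝ} {p₁ lam δ₀ δ₁ : ℝ} (hr : 0 < r) (hP : P.PosDef)
    (hp : 0 < p₁) (hlam : 0 ≤ lam) (hlam' : lam ≤ 2 * p₁)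
    (hΘ₁ : NegDef (Theta1 A A₁ B a a₂ K c r P p₁ lam δ₀ δ₁))
    (hΘ₂ : NegDef (Theta2 a₂ c r p₁ lam δ₀ δ₁)) :
    ∃ ε₀ : ℝ, 0 < ε₀ ∧ ∀ ε : ℝ, ε ≤ ε₀ →
      WeightedLMI A A₁ B a a₂ K c 0 (zeta A K a c) r P p₁ lam (δ₀ + ε) δ₁ := by
  obtain ⟨κ₁, hκ₁, h₁⟩ := hΘ₁.exists_quadForm_le
  obtain ⟨κ₂, hκ₂, h₂⟩ := hΘ₂.exists_quadForm_le
  obtain ⟨C, hC, hPC⟩ := exists_quadForm_le P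
  refine ⟨min (κ₁ / (2 * C)) (κ₂ / (2 * p₁)), by positivity, fun ε hε => ?_⟩
  have hε₁ : 2 * ε * C ≤ κ₁ := by
    have := (le_div_iff₀ (by positivity)).mp (hε.trans (min_le_left _ _))
    linarith
  have hε₂ : 2 * ε * p₁ ≤ κ₂ := by
    have := (le_div_iff₀ (by positivity)).mp (hε.trans (min_le_right _ _))
    linarith
  refine ⟨hr, hp, hlam, hlam', hP, fun ξ x hx => ?_, fun x y s => ?_, fun p q => ?_⟩
  · simpa using sq_couplingRow_mulVec_le_zeta A K a c ξ hx
  · have h := h₁ (Sum.elim (Sum.elim x y) (fun _ => s))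
    rw [dotProduct_Theta1_mulVec _ _ _ _ _ _ _ _ hP] at h
    simp only [sumElim_dotProduct_sumElim] at h
    have hy := dotProduct_self_nonneg' y
    have hs := dotProduct_self_nonneg' (fun _ : Fin 1 => s)
    have hx := dotProduct_self_nonneg' x
    have hPx : 0 ≤ x ⬝ᵥ (P *ᵥ x) := by simpa using hP.posSemidef.dotProduct_mulVec_nonneg x
    have hx' : 2 * ε * (x ⬝ᵥ (P *ᵥ x)) ≤ κ₁ * (x ⬝ᵥ x) := by
      rcases le_total ε 0 with h0 | h0
      · have := mul_nonneg hκ₁.le hx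
        nlinarith
      · calc 2 * ε * (x ⬝ᵥ (P *ᵥ x)) ≤ 2 * ε * (C * (x ⬝ᵥ x)) :=
              mul_le_mul_of_nonneg_left (hPC x) (by positivity)
          _ = 2 * ε * C * (x ⬝ᵥ x) := by ring
          _ ≤ κ₁ * (x ⬝ᵥ x) := mul_le_mul_of_nonneg_right hε₁ hx
    have hy' := mul_nonneg hκ₁.le hy
    have hs' := mul_nonneg hκ₁.le hs
    linarith
  · have h := h₂ ![p, q]
    rw [dotProduct_Theta2_mulVec] at h
    have hpq : ![p, q] ⬝ᵥ ![p, q] = p ^ 2 + q ^ 2 := by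
      simp [dotProduct, Fin.sum_univ_two, sq]
    rw [hpq] at h
    have hp' := mul_le_mul_of_nonneg_right hε₂ (sq_nonneg p)
    have hq' := mul_nonneg hκ₂.le (sq_nonneg q)
    linarith

theorem WeightedLMI.halanayBound {n : ℕ} {A A₁ : Matrix (Fin n) (Fin n) ℝ}
    {B : Matrix (Fin n) (Fin 1) ℝ} {a a₂ : ℝ} {K : Matrix (Fin 1) (Fin n) ℝ} {c Z r : ℝ}
    {P : Matrix (Fin n) (Fin n) ℝ} {p₁ lam δ₀ δ₁ h δ : ℝ}
    (hL : WeightedLMI A A₁ B a a₂ K c 0 Z r P p₁ lam δ₀ δ₁)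
    (hδ : 0 ≤ δ) (hδ₁ : 0 ≤ δ₁) (hrate : δ = δ₀ - δ₁ * Real.exp (2 * δ * h)) :
    HalanayBound A A₁ B a a₂ K c P p₁ h δ := by
  intro h₀ τ hτ f φ hinit X z hsol t ht
  have := hL.weightedV_le hδ hδ₁ hrate hτ hinit hsol ht
  rwa [weightedV_zero] at this

/-! ### Stabilization with an arbitrary decay rate -/

theorem weightedInner_self_le {μ : ℝ} (hμ : 0 ≤ μ) (z : L2unit) :
    weightedInner μ z z ≤ weightedInner 0 z z := by
  refine integral_mono_ae (integrable_weighted μ z z) (integrable_weighted 0 z z) ?_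
  filter_upwards [ae_restrict_mem measurableSet_Ioo] with x hx
  refine mul_le_mul_of_nonneg_right (Real.exp_le_exp.mpr ?_) (mul_self_nonneg _)
  nlinarith [mul_nonneg hμ hx.1.le]

theorem exp_mul_weightedInner_self_le {μ : ℝ} (hμ : 0 ≤ μ) (z : L2unit) :
    Real.exp (-(2 * μ)) * weightedInner 0 z z ≤ weightedInner μ z z := by
  rw [weightedInner, weightedInner, ← integral_const_mul]
  refine integral_mono_ae ((integrable_weighted 0 z z).const_mul _) (integrable_weighted μ z z) ?_
  filter_upwards [ae_restrict_mem measurableSet_Ioo] with x hx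
  simp only [mul_zero, neg_zero, zero_mul, Real.exp_zero, one_mul]
  refine mul_le_mul_of_nonneg_right (Real.exp_le_exp.mpr ?_) (mul_self_nonneg _)
  nlinarith [mul_le_of_le_one_right hμ hx.2.le]

theorem sq_stateNorm {n : ℕ} (X : ℝ → Fin n → ℝ) (z : ℝ → L2unit) (t : ℝ) :
    stateNorm X z t ^ 2 = X t ⬝ᵥ X t + weightedInner 0 (z t) (z t) := by
  have h : ∫ x, (z t x) ^ 2 ∂unitMeasure = weightedInner 0 (z t) (z t) := by
    simp [weightedInner_self]
  rw [stateNorm, h, Real.sq_sqrt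
    (add_nonneg (dotProduct_self_nonneg' _) (weightedInner_self_nonneg _ _))]

/-- For `μ ≥ 0` the weighted functional is equivalent to the square of the norm of the state. -/
theorem exists_weightedV_equiv {n : ℕ} {P : Matrix (Fin n) (Fin n) ℝ} (hP : P.PosDef) {p₁ μ : ℝ}
    (hp : 0 < p₁) (hμ : 0 ≤ μ) :
    ∃ m C : ℝ, 0 < m ∧ 0 < C ∧ ∀ (X : ℝ → Fin n → ℝ) (z : ℝ → L2unit) (t : ℝ),
      m * stateNorm X z t ^ 2 ≤ weightedV P p₁ μ X z t ∧
        weightedV P p₁ μ X z t ≤ C * stateNorm X z t ^ 2 := by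
  obtain ⟨κ, hκ, hPκ⟩ := hP.exists_le_quadForm
  obtain ⟨C, hC, hPC⟩ := exists_quadForm_le P
  refine ⟨min κ (p₁ * Real.exp (-(2 * μ))), C + p₁, by positivity, by positivity,
    fun X z t => ?_⟩
  have hx := dotProduct_self_nonneg' (X t)
  have hz := weightedInner_self_nonneg 0 (z t)
  rw [sq_stateNorm, weightedV]
  constructor
  · have h1 := mul_le_mul_of_nonneg_right (min_le_left κ (p₁ * Real.exp (-(2 * μ)))) hx
    have h2 := mul_le_mul_of_nonneg_right (min_le_right κ (p₁ * Real.exp (-(2 * μ)))) hz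
    have h3 := mul_le_mul_of_nonneg_left (exp_mul_weightedInner_self_le hμ (z t)) hp.le
    have h4 := hPκ (X t)
    linarith
  · have h1 := mul_le_mul_of_nonneg_left (weightedInner_self_le hμ (z t)) hp.le
    have h2 := hPC (X t)
    have h3 := mul_nonneg hp.le hx
    have h4 := mul_nonneg hC.le hz
    linarith

theorem WeightedLMI.expStable {n : ℕ} {A A₁ : Matrix (Fin n) (Fin n) ℝ}
    {B : Matrix (Fin n) (Fin 1) ℝ} {a a₂ : ℝ} {K : Matrix (Fin 1) (Fin n) ℝ} {c μ Z r : ℝ}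
    {P : Matrix (Fin n) (Fin n) ℝ} {p₁ lam δ₀ δ₁ h δ : ℝ}
    (hL : WeightedLMI A A₁ B a a₂ K c μ Z r P p₁ lam δ₀ δ₁) (hμ : 0 ≤ μ) (hh : 0 ≤ h)
    (hδ : 0 ≤ δ) (hδ₁ : 0 ≤ δ₁) (hrate : δ = δ₀ - δ₁ * Real.exp (2 * δ * h)) :
    ExpStable A A₁ B a a₂ K c h δ := by
  obtain ⟨m, C, hm, hC, hequiv⟩ := exists_weightedV_equiv hL.posDef hL.p₁_pos hμ
  refine ⟨Real.sqrt (C / m), by positivity, fun h₀ τ hτ f φ hinit X z hsol t ht => ?_⟩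
  have hV := hL.weightedV_le hδ hδ₁ hrate hτ hinit hsol ht
  have hbddV := bddAbove_weightedV_initial hinit hsol P p₁ μ
  have hnn : ∀ t, 0 ≤ stateNorm X z t := fun t => Real.sqrt_nonneg _
  have hbdd : BddAbove (stateNorm X z '' Icc (-h) 0) := by
    obtain ⟨b, hb⟩ := hbddV
    refine ⟨Real.sqrt (b / m), forall_mem_image.mpr fun θ hθ => Real.le_sqrt_of_sq_le ?_⟩
    rw [le_div_iff₀ hm, mul_comm]
    exact (hequiv X z θ).1.trans (hb (mem_image_of_mem _ hθ))
  set S := sSup (stateNorm X z '' Icc (-h) 0) with hS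
  have hS0 : 0 ≤ S := Real.sSup_nonneg (forall_mem_image.mpr fun θ _ => hnn θ)
  have hVS : sSup (weightedV P p₁ μ X z '' Icc (-h) 0) ≤ C * S ^ 2 := by
    refine csSup_le ((nonempty_Icc.mpr (by linarith)).image _) (forall_mem_image.mpr ?_)
    intro θ hθ
    refine (hequiv X z θ).2.trans (mul_le_mul_of_nonneg_left ?_ hC.le)
    exact pow_le_pow_left₀ (hnn θ) (le_csSup hbdd (mem_image_of_mem _ hθ)) 2
  have hexp : Real.exp (-2 * δ * t) = Real.exp (-δ * t) ^ 2 := by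
    rw [← Real.exp_nat_mul]
    congr 1
    push_cast
    ring
  have h1 : m * stateNorm X z t ^ 2 ≤ Real.exp (-δ * t) ^ 2 * (C * S ^ 2) := by
    rw [← hexp]
    exact ((hequiv X z t).1.trans hV).trans
      (mul_le_mul_of_nonneg_left hVS (Real.exp_pos _).le)
  refine le_of_sq_le_sq ?_ (by positivity)
  rw [mul_pow, mul_pow, Real.sq_sqrt (by positivity), div_mul_eq_mul_div, div_mul_eq_mul_div,
    le_div_iff₀ hm]
  linarith

/-- For `A₁ = a₁ I` and a controllable pair the inequalities are feasible. The
feedback `K` and `P`, `p₁`, `λ`, `r` are fixed first; then `s`, with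
`c = s² - a` and `μ = s - 1`, is taken so large that `c - μ² = 2s - 1 - a` dominates. This is
possible because the bound for the weighted coupling row does not depend on `s`. -/
theorem Controllable.exists_weightedLMI {n : ℕ} {A : Matrix (Fin n) (Fin n) ℝ}
    {B : Matrix (Fin n) (Fin 1) ℝ} (hAB : Controllable A B) (a a₁ a₂ : ℝ) {δ₀ : ℝ}
    (hδ₀ : 0 ≤ δ₀) :
    ∃ (K : Matrix (Fin 1) (Fin n) ℝ) (c μ Z r : ℝ) (P : Matrix (Fin n) (Fin n) ℝ) (p₁ lam : ℝ),
      0 < c ∧ 0 ≤ μ ∧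
        WeightedLMI A (a₁ • (1 : Matrix (Fin n) (Fin n) ℝ)) B a a₂ K c μ Z r P p₁ lam δ₀ 1 := by
  obtain ⟨K, P, hP, hdecay⟩ := hAB.exists_feedback (δ₀ + a₁ ^ 2 / 2 + 1 / 2)
  obtain ⟨κ, hκ, hPκ⟩ := hP.exists_le_quadForm
  set β : Fin n → ℝ := B *ᵥ fun _ => 1 with hβ
  have hPnn : ∀ x, 0 ≤ x ⬝ᵥ (P *ᵥ x) := fun x => by
    simpa using hP.posSemidef.dotProduct_mulVec_nonneg x
  set p₁ : ℝ := (β ⬝ᵥ (P *ᵥ β)) / 2 + 1 with hp₁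
  have hp : 0 < p₁ := by
    have := hPnn β
    positivity
  set Z : ℝ := (gammaSup A K a * Real.exp 1) ^ 2 with hZ
  set r : ℝ := p₁ * Z * (a₁ - a₂) ^ 2 / κ + 1 with hr
  have hr0 : 0 < r := by positivity
  set s : ℝ := 1 + |a| + (2 * δ₀ + r + a₂ ^ 2) / 4 with hs
  have hs1 : 1 + |a| ≤ s := by
    have : 0 ≤ (2 * δ₀ + r + a₂ ^ 2) / 4 := by positivity
    linarith
  have ha := abs_nonneg a
  refine ⟨K, s ^ 2 - a, s - 1, Z, r, P, p₁, 2 * p₁, ?_, by linarith, hr0, hp, by linarith, le_rfl,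
    hP, fun ξ x hx => ?_, fun x y v => ?_, fun p q => ?_⟩
  · nlinarith [le_abs_self a]
  · exact sq_weighted_couplingRow_mulVec_le A K (by linarith) (by ring) ξ hx
  · have hBv : (B *ᵥ fun _ : Fin 1 => v) = v • β := by
      rw [hβ, ← Matrix.mulVec_smul]
      congr 1
      funext i
      simp
    have hAy : (a₁ • (1 : Matrix (Fin n) (Fin n) ℝ) - a₂ • (1 : Matrix (Fin n) (Fin n) ℝ)) *ᵥ y =
        (a₁ - a₂) • y := by
      rw [← sub_smul, Matrix.smul_mulVec, Matrix.one_mulVec]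
    rw [hBv, hAy, Matrix.smul_mulVec, Matrix.one_mulVec]
    simp only [Matrix.mulVec_add, Matrix.mulVec_smul, dotProduct_add, dotProduct_smul,
      smul_dotProduct, smul_eq_mul]
    have hx := hdecay x
    -- completing squares for the delayed term and for the boundary value
    have h1 := hPnn (a₁ • x - y)
    have h2 := hPnn (x - v • β)
    simp only [Matrix.mulVec_sub, Matrix.mulVec_smul, dotProduct_sub, sub_dotProduct,
      smul_dotProduct, dotProduct_smul, smul_eq_mul, hP.dotProduct_mulVec_comm y x,
      hP.dotProduct_mulVec_comm β x] at h1 h2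
    have h3 : p₁ * r⁻¹ * (Z * ((a₁ - a₂) * ((a₁ - a₂) * (y ⬝ᵥ y)))) ≤ y ⬝ᵥ (P *ᵥ y) := by
      refine le_trans ?_ (hPκ y)
      have hrκ : p₁ * Z * (a₁ - a₂) ^ 2 ≤ κ * r := by
        rw [hr, mul_add, mul_div_cancel₀ _ hκ.ne']
        linarith
      have h4 := mul_le_mul_of_nonneg_right hrκ
        (mul_nonneg (inv_pos.mpr hr0).le (dotProduct_self_nonneg' y))
      calc _ = p₁ * Z * (a₁ - a₂) ^ 2 * (r⁻¹ * (y ⬝ᵥ y)) := by ring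
        _ ≤ _ := h4
        _ = κ * (y ⬝ᵥ y) := by field_simp
    have h5 : β ⬝ᵥ (P *ᵥ β) = 2 * p₁ - 2 := by rw [hp₁]; ring
    rw [h5] at h2
    nlinarith [sq_nonneg v]
  · have h1 : 2 * δ₀ + r + a₂ ^ 2 ≤ 2 * (s ^ 2 - a - (s - 1) ^ 2) := by
      have := le_abs_self a
      nlinarith
    have h2 : (-2 * (s ^ 2 - a - (s - 1) ^ 2) + 2 * δ₀ + r) * p ^ 2 ≤ -a₂ ^ 2 * p ^ 2 :=
      mul_le_mul_of_nonneg_right (by linarith) (sq_nonneg p)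
    have h3 : (-2 * (s ^ 2 - a - (s - 1) ^ 2) + 2 * δ₀ + r) * p ^ 2 + 2 * a₂ * (p * q) -
        2 * q ^ 2 ≤ 0 := by
      nlinarith [sq_nonneg (a₂ * p - q), sq_nonneg q]
    have h4 := mul_nonpos_of_nonneg_of_nonpos hp.le h3
    linarith

end Cascade

theorem mainTheorem1 {n : ℕ} (A A₁ : Matrix (Fin n) (Fin n) ℝ) (B : Matrix (Fin n) (Fin 1) ℝ)
    (a a₂ : ℝ) :
    -- (i), the case `δ₁ < δ₀`
    (∀ (K : Matrix (Fin 1) (Fin n) ℝ) (c r δ₀ δ₁ : ℝ),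
      0 < c → 0 < r → 0 < δ₁ → δ₁ < δ₀ →
      ∀ (P : Matrix (Fin n) (Fin n) ℝ) (p₁ lam : ℝ),
        P.PosDef → 0 < p₁ → 0 < lam → lam ≤ 2 * p₁ →
        Cascade.NegDef (Cascade.Theta1 A A₁ B a a₂ K c r P p₁ lam δ₀ δ₁) →
        Cascade.NegDef (Cascade.Theta2 a₂ c r p₁ lam δ₀ δ₁) →
        ∀ h : ℝ, 0 < h →
          ∃ δ : ℝ, 0 < δ ∧ δ = δ₀ - δ₁ * Real.exp (2 * δ * h) ∧
            (∀ δ' : ℝ, δ' = δ₀ - δ₁ * Real.exp (2 * δ' * h) → δ' = δ) ∧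
            Cascade.HalanayBound A A₁ B a a₂ K c P p₁ h δ) ∧
    -- (i), the case `δ₁ = δ₀`
    (∀ (K : Matrix (Fin 1) (Fin n) ℝ) (c r δ₀ : ℝ),
      0 < c → 0 < r → 0 < δ₀ →
      ∀ (P : Matrix (Fin n) (Fin n) ℝ) (p₁ lam : ℝ),
        P.PosDef → 0 < p₁ → 0 < lam → lam ≤ 2 * p₁ →
        Cascade.NegDef (Cascade.Theta1 A A₁ B a a₂ K c r P p₁ lam δ₀ δ₀) →
        Cascade.NegDef (Cascade.Theta2 a₂ c r p₁ lam δ₀ δ₀) →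
        ∀ h : ℝ, 0 < h →
          ∃ δ : ℝ, 0 < δ ∧ Cascade.HalanayBound A A₁ B a a₂ K c P p₁ h δ) ∧
    -- (ii)
    (∀ a₁ : ℝ, A₁ = a₁ • (1 : Matrix (Fin n) (Fin n) ℝ) → Cascade.Controllable A B →
      ∀ h : ℝ, 0 < h → ∀ δ : ℝ, 0 < δ →
        ∃ (K : Matrix (Fin 1) (Fin n) ℝ) (c : ℝ), 0 < c ∧
          Cascade.ExpStable A A₁ B a a₂ K c h δ) := by
  
  refine ⟨?_, ?_, ?_⟩
  · intro K c r δ₀ δ₁ _ hr hδ₁ hδ P p₁ lam hP hp hlam hlam' hΘ₁ hΘ₂ h hh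
    obtain ⟨ε₀, hε₀, hL⟩ :=
      Cascade.WeightedLMI.exists_of_negDef hr hP hp hlam.le hlam' hΘ₁ hΘ₂
    have hL0 := hL 0 hε₀.le
    rw [add_zero] at hL0
    obtain ⟨δ, hδ0, hrate, huniq⟩ := Cascade.exists_unique_decay_rate hδ₁ hδ hh
    exact ⟨δ, hδ0, hrate, huniq, hL0.halanayBound hδ0.le hδ₁.le hrate⟩
  · intro K c r δ₀ _ hr hδ₀ P p₁ lam hP hp hlam hlam' hΘ₁ hΘ₂ h hh
    obtain ⟨ε₀, hε₀, hL⟩ :=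
      Cascade.WeightedLMI.exists_of_negDef hr hP hp hlam.le hlam' hΘ₁ hΘ₂
    -- the strict inequalities hold with `δ₀ + ε₀` in place of `δ₀`
    obtain ⟨δ, hδ0, hrate, -⟩ :=
      Cascade.exists_unique_decay_rate hδ₀ (lt_add_of_pos_right δ₀ hε₀) hh
    exact ⟨δ, hδ0, (hL ε₀ le_rfl).halanayBound hδ0.le hδ₀.le hrate⟩
  · rintro a₁ rfl hAB h hh δ hδ
    -- with `δ₁ = 1`, the rate `δ` is reached for `δ₀ = δ + e^{2δh}`
    obtain ⟨K, c, μ, Z, r, P, p₁, lam, hc, hμ, hL⟩ :=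
      hAB.exists_weightedLMI a a₁ a₂ (δ₀ := δ + Real.exp (2 * δ * h)) (by positivity)
    exact ⟨K, c, hc, hL.expStable hμ hh.le hδ.le zero_le_one (by ring)⟩
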